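/- Let $F$ be the distribution function of a probability measure on $\mathbb R$, with quantile function $Q(s)=\inf\{x: F(x)\ge s\}$, and suppose that $Q(1-s)=s^{-\gamma}\ell(s)$ for $s\in(0,1)$, where $\gamma>0$ and $\ell$ is slowly varying at $0$. Assume that there is a function $a$, regularly varying at $0$, such that $$\limsup_{v\downarrow0}\ \sup_{u\in(0,1]}\frac{|\ell(uv)-\ell(v)|}{a(v)}<\infty ,\qquad \lim_{v\downarrow0}\frac{a(v)}{\ell(v)}=0 .$$ (Regular variation at $0$ with index $\rho\in\mathbb R$ means: positive and measurable on some $(0,\delta)$, with $f(uv)/f(v)\to u^\rho$ as $v\downarrow 0$ for all $u>0$; slow variation is the case $\rho=0$.) Let $U_1,U_2,\dots$ be independent uniform$(0,1)$ random variables and let $U_{1,n}\le\dots\le U_{n,n}$ be the order statistics of $U_1,\dots,U_n$. Let $k_n$ be integers with $k_n\to\infty$, $k_n/n\to0$, and let $p_n$ be real numbers with $p_n\to\infty$ and $$p_n\,\frac{a(k_n/n)}{\ell(k_n/n)}\to0 .$$ Put $\alpha=\liminf_{n\to\infty}\frac{\log k_n}{p_n}\in[0,\infty]$, and, for $p>0$,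 $m_p=\gamma^p\Gamma(p+1)$ and $\sigma_p^2=\gamma^{2p}\left(\Gamma(2p+1)-\Gamma(p+1)^2\right)$ with $\sigma_p>0$ (the mean and the variance of $(-\gamma\log U)^p$ for $U$ uniform on $(0,1)$). 1. If $\alpha>1$, then, in probability as $n\to\infty$, $$\frac1{k_n m_{p_n}}\sum_{i=1}^{k_n}\left(\log\frac{Q(1-U_{i,n})}{Q(1-U_{k_n+1,n})}\right)^{p_n}\longrightarrow 1 .$$ 2. If $\alpha>2$ and, in addition, $$\limsup_{n\to\infty}\frac1{p_n}\log\left(\sqrt{k_n}\,\frac{a(k_n/n)}{\ell(k_n/n)}\right)<\log 2 ,$$ then, in distribution as $n\to\infty$, $$\frac1{\sqrt{k_n}\,\sigma_{p_n}}\sum_{i=1}^{k_n}\left[\left(\log\frac{Q(1-U_{i,n})}{Q(1-U_{k_n+1,n})}\right)^{p_n}-m_{p_n}\right]\longrightarrow N(0,1).$$ -/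

import Mathlib

open MeasureTheory ProbabilityTheory Filter Topology Set

noncomputable section

/-- `f` is regularly varying at `0` (from the right) with index `ρ`: it is positive and Borel
measurable on some interval `(0, δ)`, and `f (u v) / f v → u ^ ρ` as `v ↓ 0` for every `u > 0`.
Values of `f` outside a right neighbourhood of `0` play no role. -/
structure RegularlyVaryingAtZero (f : ℝ → ℝ) (ρ : ℝ) : Prop where
  pos_measurable : ∃ δ : ℝ, 0 < δ ∧ (∀ v ∈ Ioo 0 δ, 0 < f v) ∧
    Measurable (fun v : Ioo (0 : ℝ) δ => f v)
  tendsto_ratio : ∀ u : ℝ, 0 < u →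
    Tendsto (fun v => f (u * v) / f v) (𝓝[>] 0) (𝓝 (u ^ ρ))

/-- Slowly varying at `0`: regularly varying with index `0`. -/
def SlowlyVaryingAtZero (f : ℝ → ℝ) : Prop := RegularlyVaryingAtZero f 0

/-- The quantile function `Q(s) = inf {x : F(x) ≥ s}` of the distribution `ν` with distribution
function `F = cdf ν`; it is the genuine one for `s ∈ (0, 1)`. -/
def quantile (ν : Measure ℝ) (s : ℝ) : ℝ := sInf {x : ℝ | s ≤ cdf ν x}

/-- The `i`-th smallest (`1 ≤ i ≤ n`) of the first `n` terms `x 0, …, x (n - 1)` of a sequence;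
`0` for an index outside this range. -/
def orderStat (x : ℕ → ℝ) (n i : ℕ) : ℝ :=
  if h : 1 ≤ i ∧ i ≤ n then
    ((fun j : Fin n => x j) ∘ Tuple.sort (fun j : Fin n => x j)) ⟨i - 1, by omega⟩
  else 0

/-- The uniform second-order condition
`limsup_{v ↓ 0} sup_{u ∈ (0, 1]} |ℓ (u v) - ℓ v| / a v < ∞`. -/
def UniformSecondOrder (ℓ a : ℝ → ℝ) : Prop :=
  limsup (fun v : ℝ => ⨆ u ∈ Ioc (0 : ℝ) 1, ((|ℓ (u * v) - ℓ v| / a v : ℝ) : EReal))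
    (𝓝[>] 0) < ⊤

/-- `m_p = E (-γ log U)^p = γ ^ p Γ(p + 1)` with `U` uniform on `(0, 1)`. -/
def mLim (γ p : ℝ) : ℝ := γ ^ p * Real.Gamma (p + 1)

/-- `σ_p`, the standard deviation of `(-γ log U)^p`:
`σ_p ^ 2 = γ ^ (2 p) (Γ(2 p + 1) - Γ(p + 1) ^ 2)`. -/
def sigmaLim (γ p : ℝ) : ℝ :=
  √(γ ^ (2 * p) * (Real.Gamma (2 * p + 1) - Real.Gamma (p + 1) ^ 2))

/-- The summand `(log (Q(1 - U_{i,n}) / Q(1 - U_{k+1,n}))) ^ p`, for a sample `x` of the uniform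
sequence `U`. -/
def logExcessPow (ν : Measure ℝ) (x : ℕ → ℝ) (n k : ℕ) (p : ℝ) (i : ℕ) : ℝ :=
  (Real.log (quantile ν (1 - orderStat x n i) / quantile ν (1 - orderStat x n (k + 1)))) ^ p

end

/-! Write `E = -log U`, a standard exponential variable, and `ε = C a(k/n)/ℓ(k/n)`, which tends to
`0`. The log-excess at rank `i` equals `γ log (U_{k+1,n}/U_{i,n})` plus `log
(ℓ(U_{i,n})/ℓ(U_{k+1,n}))`. The argument treats the first term exactly and shows that the second is
negligible.

Exact part. Symmetric sums of the ratios `U_{i,n}/U_{k+1,n}`, `i ≤ k`, have the law of the same sums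
over `k` independent uniforms (`measure_sum_sortedVec_ratio`). This leaves row-wise i.i.d. sums of
`(γE)^p` with `p → ∞`. The key estimate `Γ((1+r)p+1) ≤ (1+r)^((1+r)p+1) Γ(p+1)^(1+r)` makes the
normalized moment of order `1+r` grow no faster than about `exp(r(1+r)p)`, which `k^r` beats as soon
as `log k ≥ (1+η)p` with `η > r`. Truncation then gives the weak law for `α > 1`. The same estimate
at `2p` is a Lyapunov condition of order `2+2r` and gives the central limit theorem for `α > 2`.

Error part. Chebyshev's inequality puts `U_{k+1,n}` below `2k/n` with probability tending to one,
and there the second-order condition bounds the slowly varying term by `ε` uniformly. A `p`-th power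
then moves by at most `pε(γE+ε)^(p-1)`, whose mean is at most `(ε/γ)exp(ε/γ) m_p`: the shift by `ε`
costs a bounded factor, and `pΓ(p) = Γ(p+1)` absorbs `p`. By Markov's inequality the total error is
of order `k ε m_p`. Relative to `k m_p` this is `ε`. Relative to `√k σ_p` it is `√k ε m_p/σ_p`, and
the duplication formula gives `m_p/σ_p = O(√p 2^(-p))`; this is the origin of the threshold `log 2`.
-/

/-! ### Order statistics as a map on `Fin n → ℝ` -/

/-- The increasing rearrangement of a finite real vector. -/
noncomputable def sortedVec {n : ℕ} (x : Fin n → ℝ) : Fin n → ℝ := x ∘ Tuple.sort x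

theorem monotone_sortedVec {n : ℕ} (x : Fin n → ℝ) : Monotone (sortedVec x) :=
  Tuple.monotone_sort x

theorem sortedVec_comp_perm {n : ℕ} (x : Fin n → ℝ) (τ : Equiv.Perm (Fin n)) :
    sortedVec (x ∘ τ) = sortedVec x :=
  Tuple.comp_perm_comp_sort_eq_comp_sort

/-- All sorted rearrangements of a vector coincide, so the event `sortedVec x i ≤ t` is a finite
union, over permutations, of sets cut out by finitely many coordinate inequalities. -/
theorem measurable_sortedVec {n : ℕ} (i : Fin n) :
    Measurable (fun x : Fin n → ℝ => sortedVec x i) := by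
  refine measurable_of_Iic fun t => ?_
  have h : (fun x : Fin n → ℝ => sortedVec x i) ⁻¹' Iic t =
      ⋃ σ : Equiv.Perm (Fin n),
        ({x : Fin n → ℝ | ∀ a b, a ≤ b → x (σ a) ≤ x (σ b)} ∩ {x | x (σ i) ≤ t}) := by
    ext x
    simp only [mem_preimage, mem_Iic, mem_iUnion, mem_inter_iff, mem_ofPred_eq]
    constructor
    · intro hx
      exact ⟨Tuple.sort x, fun a b hab => Tuple.monotone_sort x hab, hx⟩
    · rintro ⟨σ, hσ, hx⟩
      have : x ∘ σ = x ∘ Tuple.sort x :=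
        Tuple.comp_sort_eq_comp_iff_monotone.2 fun a b hab => hσ a b hab
      have := congrFun this i
      simp only [Function.comp_apply] at this
      simpa [sortedVec, ← this] using hx
  rw [h]
  refine MeasurableSet.iUnion fun σ => MeasurableSet.inter ?_ ?_
  · simp only [ofPred_forall]
    exact MeasurableSet.iInter fun a => MeasurableSet.iInter fun b => MeasurableSet.iInter fun _ =>
      measurableSet_le (by fun_prop) (by fun_prop)
  · exact measurableSet_le (by fun_prop) (by fun_prop)

theorem orderStat_eq_sortedVec (x : ℕ → ℝ) {n : ℕ} (i : Fin n) :
    orderStat x n (i + 1) = sortedVec (fun j : Fin n => x j) i := by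
  have h : 1 ≤ (i : ℕ) + 1 ∧ (i : ℕ) + 1 ≤ n := ⟨by omega, i.2⟩
  rw [orderStat, dif_pos h]
  rfl

theorem measurable_orderStat (n i : ℕ) : Measurable (fun x : ℕ → ℝ => orderStat x n i) := by
  by_cases h : 1 ≤ i ∧ i ≤ n
  · have : (fun x : ℕ → ℝ => orderStat x n i) =
        fun x => sortedVec (fun j : Fin n => x j) ⟨i - 1, by omega⟩ := by
      funext x
      rw [← orderStat_eq_sortedVec]
      simp only
      congr
      omega
    have hr : Measurable fun (x : ℕ → ℝ) (j : Fin n) => x j := by fun_prop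
    rw [this]
    exact (measurable_sortedVec _).comp hr
  · have : (fun x : ℕ → ℝ => orderStat x n i) = fun _ => 0 := by
      funext x
      rw [orderStat, dif_neg h]
    rw [this]
    exact measurable_const

theorem sum_Icc_orderStat (x : ℕ → ℝ) {n : ℕ} (k : Fin n) (f : ℝ → ℝ) :
    ∑ i ∈ Finset.Icc 1 (k : ℕ), f (orderStat x n i) =
      ∑ i ∈ Finset.Iio k, f (sortedVec (fun j : Fin n => x j) i) := by
  symm
  refine Finset.sum_bij (fun i _ => (i : ℕ) + 1) ?_ ?_ ?_ ?_
  · intro i hi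
    rw [Finset.mem_Iio, Fin.lt_def] at hi
    rw [Finset.mem_Icc]
    omega
  · intro i _ j _ h
    exact Fin.ext (by omega)
  · intro b hb
    rw [Finset.mem_Icc] at hb
    refine ⟨⟨b - 1, by have := k.2; omega⟩, ?_, ?_⟩
    · rw [Finset.mem_Iio, Fin.lt_def]
      simp only
      omega
    · simp only
      omega
  · intro i _
    rw [orderStat_eq_sortedVec]

/-- If the order statistic of rank `k` (counted from `0`) exceeds `t`, at most `k` coordinates are
`≤ t`. -/
theorem card_le_of_lt_sortedVec {n : ℕ} (x : Fin n → ℝ) (k : Fin n) {t : ℝ}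
    (h : t < sortedVec x k) : (Finset.univ.filter fun j => x j ≤ t).card ≤ k := by
  rw [← Fin.card_Iio]
  -- The inverse of the sorting permutation assigns to each coordinate its rank; a coordinate `≤ t`
  -- must have rank below `k`.
  refine Finset.card_le_card_of_injOn (fun j => (Tuple.sort x).symm j) ?_
    (fun a _ b _ hab => (Tuple.sort x).symm.injective hab)
  intro j hj
  simp only [Finset.coe_filter, Finset.mem_univ, true_and, mem_ofPred_eq] at hj
  simp only [Finset.coe_Iio, mem_Iio]
  by_contra hlt
  have := monotone_sortedVec x (not_lt.1 hlt)
  simp only [sortedVec, Function.comp_apply, Equiv.apply_symm_apply] at this h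
  linarith

/-! ### Vectors whose coordinate `k` separates the earlier from the later coordinates -/

/-- The vectors with `x i < x k` for `i < k` and `x k < x i` for `k < i`. -/
def pivotSet {n : ℕ} (k : Fin n) : Set (Fin n → ℝ) :=
  {x | (∀ i, i < k → x i < x k) ∧ ∀ i, k < i → x k < x i}

theorem measurableSet_pivotSet {n : ℕ} (k : Fin n) : MeasurableSet (pivotSet k) := by
  simp only [pivotSet, ofPred_and, ofPred_forall]
  exact (MeasurableSet.iInter fun i => MeasurableSet.iInter fun _ =>
      measurableSet_lt (by fun_prop) (by fun_prop)).inter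
    (MeasurableSet.iInter fun i => MeasurableSet.iInter fun _ =>
      measurableSet_lt (by fun_prop) (by fun_prop))

/-- On `pivotSet k`, the `k` smallest coordinates are the first `k` ones. -/
theorem sum_sortedVec_of_mem_pivotSet {n : ℕ} {k : Fin n} {x : Fin n → ℝ} (hx : x ∈ pivotSet k)
    (φ : ℝ → ℝ) :
    ∑ i ∈ Finset.Iio k, φ (sortedVec x i / sortedVec x k) =
      ∑ i ∈ Finset.Iio k, φ (x i / x k) := by
  obtain ⟨h1, h2⟩ := hx
  set σ := Tuple.sort x with hσ
  have hmono : ∀ a b, a ≤ b → x (σ a) ≤ x (σ b) := fun a b hab => Tuple.monotone_sort x hab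
  -- `q` is the rank of coordinate `k`. Sorting embeds the ranks below `q` into the indices below
  -- `k`, and those above into those above, so counting forces `q = k`.
  set q := σ.symm k with hq
  have hqk : σ q = k := by simp [hq]
  have hlt : ∀ j, j < q → σ j < k := by
    intro j hj
    by_contra hc
    rcases (not_lt.1 hc).eq_or_lt with h | h
    · exact hj.ne (by rw [hq, h, Equiv.symm_apply_apply])
    · have := h2 _ h
      have := hmono j q hj.le
      rw [hqk] at this
      linarith
  have hgt : ∀ j, q < j → k < σ j := by
    intro j hj
    by_contra hc
    rcases (not_lt.1 hc).eq_or_lt with h | h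
    · exact hj.ne' (by rw [hq, ← h, Equiv.symm_apply_apply])
    · have := h1 _ h
      have := hmono q j hj.le
      rw [hqk] at this
      linarith
  have hc1 : (Finset.Iio q).card ≤ (Finset.Iio k).card :=
    Finset.card_le_card_of_injOn σ (fun j hj => by simpa using hlt j (by simpa using hj))
      σ.injective.injOn
  have hc2 : (Finset.Ioi q).card ≤ (Finset.Ioi k).card :=
    Finset.card_le_card_of_injOn σ (fun j hj => by simpa using hgt j (by simpa using hj))
      σ.injective.injOn
  have hqeq : q = k := by
    rw [Fin.card_Iio, Fin.card_Iio] at hc1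
    rw [Fin.card_Ioi, Fin.card_Ioi] at hc2
    have := q.2
    have := k.2
    exact Fin.ext (by omega)
  have hk : sortedVec x k = x k := by
    change x (σ k) = x k
    rw [← hqeq, hqk, hqeq]
  rw [hk]
  refine Finset.sum_bijective σ σ.bijective ?_ (fun i _ => rfl)
  intro i
  simp only [Finset.mem_Iio]
  constructor
  · intro hi
    exact hlt i (by rwa [hqeq])
  · intro hi
    by_contra hc
    rcases (not_lt.1 hc).eq_or_lt with h | h
    · rw [← h, ← hqeq, hqk, hqeq] at hi
      exact lt_irrefl _ hi
    · exact absurd (hgt i (by rwa [hqeq])) (not_lt.2 hi.le)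

/-- For a vector with distinct coordinates the number of permutations taking it into `pivotSet k`
does not depend on the vector. -/
theorem sum_indicator_pivotSet {n : ℕ} (k : Fin n) {x : Fin n → ℝ} (hx : Function.Injective x) :
    ∑ τ : Equiv.Perm (Fin n), (pivotSet k).indicator (1 : (Fin n → ℝ) → ENNReal) (x ∘ τ) =
      ∑ τ : Equiv.Perm (Fin n),
        (pivotSet k).indicator (1 : (Fin n → ℝ) → ENNReal) (fun i => ((τ i : ℕ) : ℝ)) := by
  -- With distinct coordinates the sorted vector is strictly increasing, so membership in `pivotSet
  -- k` depends only on `τ`; left multiplication by the sorting permutation reindexes the sum.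
  have hs : StrictMono (sortedVec x) :=
    (monotone_sortedVec x).strictMono_of_injective (hx.comp (Tuple.sort x).injective)
  have key : ∀ τ : Equiv.Perm (Fin n), (sortedVec x ∘ τ ∈ pivotSet k ↔
      (fun i => ((τ i : ℕ) : ℝ)) ∈ pivotSet k) := by
    intro τ
    simp only [pivotSet, mem_ofPred_eq, Function.comp_apply, hs.lt_iff_lt, Nat.cast_lt, Fin.lt_def]
  have hsum : ∑ τ : Equiv.Perm (Fin n), (pivotSet k).indicator
      (1 : (Fin n → ℝ) → ENNReal) (x ∘ τ) =
      ∑ τ : Equiv.Perm (Fin n), (pivotSet k).indicator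
        (1 : (Fin n → ℝ) → ENNReal) (sortedVec x ∘ τ) := by
    refine (Fintype.sum_equiv (Equiv.mulLeft (Tuple.sort x)) _ _ fun τ => ?_).symm
    rfl
  rw [hsum]
  refine Finset.sum_congr rfl fun τ _ => ?_
  by_cases h : sortedVec x ∘ τ ∈ pivotSet k
  · rw [indicator_of_mem h, indicator_of_mem ((key τ).1 h)]
    rfl
  · rw [indicator_of_notMem h, indicator_of_notMem (mt (key τ).2 h)]

/-! ### The conditional law of the lower order statistics of a uniform sample -/

/-- The uniform distribution on `(0, 1)`. -/
noncomputable abbrev unif : Measure ℝ := volume.restrict (Ioo (0 : ℝ) 1)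

instance : IsProbabilityMeasure unif := ⟨by simp [unif]⟩

theorem measurePreserving_comp_perm {n : ℕ} (μ : Measure ℝ) [SigmaFinite μ]
    (τ : Equiv.Perm (Fin n)) :
    MeasurePreserving (fun x : Fin n → ℝ => x ∘ τ) (Measure.pi fun _ => μ)
      (Measure.pi fun _ => μ) := by
  have h := measurePreserving_arrowCongr' (fun _ : Fin n => μ) (fun _ : Fin n => μ) τ.symm
    (MeasurableEquiv.refl ℝ) (fun _ => MeasurePreserving.id _)
  convert! h

theorem pi_unif_eq (ι : Type*) [Fintype ι] :
    (Measure.pi fun _ : ι => unif) =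
      (volume : Measure (ι → ℝ)).restrict (univ.pi fun _ => Ioo 0 1) := by
  rw [volume_pi, Measure.restrict_pi_pi]

/-- Ties lie in the finitely many proper subspaces `x i = x j`, which are Lebesgue null. -/
theorem ae_injective_pi_unif (n : ℕ) :
    ∀ᵐ x ∂(Measure.pi fun _ : Fin n => unif), Function.Injective x := by
  have h : ∀ i j : Fin n, i ≠ j → ∀ᵐ x : Fin n → ℝ ∂(Measure.pi fun _ : Fin n => unif),
      x i ≠ x j := by
    intro i j hij
    rw [pi_unif_eq]
    refine ae_restrict_of_ae ?_
    let S : Submodule ℝ (Fin n → ℝ) :=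
      LinearMap.ker (LinearMap.proj (R := ℝ) (φ := fun _ : Fin n => ℝ) i -
        LinearMap.proj (R := ℝ) (φ := fun _ : Fin n => ℝ) j)
    have hS : S ≠ ⊤ := by
      intro hS
      have : (Pi.single i (1 : ℝ) : Fin n → ℝ) ∈ S := by rw [hS]; trivial
      simp [S, LinearMap.mem_ker, hij.symm] at this
    have h0 := Measure.addHaar_submodule (volume : Measure (Fin n → ℝ)) S hS
    rw [ae_iff]
    refine measure_mono_null (fun x hx => ?_) h0
    simp only [ne_eq, not_not, mem_ofPred_eq] at hx
    simp [S, LinearMap.mem_ker, hx]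
  have h' : ∀ᵐ x : Fin n → ℝ ∂(Measure.pi fun _ : Fin n => unif),
      ∀ i j : Fin n, i ≠ j → x i ≠ x j := by
    rw [ae_all_iff]
    intro i
    rw [ae_all_iff]
    intro j
    by_cases hij : i = j
    · exact Eventually.of_forall fun x h => absurd hij h
    · filter_upwards [h i j hij] with x hx _ using hx
  filter_upwards [h'] with x hx i j hij
  by_contra hc
  exact hx i j hc hij

/-- The number of permutations `τ` of `Fin n` in `pivotSet k`. -/
noncomputable def pivotCount {n : ℕ} (k : Fin n) : ENNReal :=
  ∑ τ : Equiv.Perm (Fin n),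
    (pivotSet k).indicator (1 : (Fin n → ℝ) → ENNReal) (fun i => ((τ i : ℕ) : ℝ))

theorem pivotCount_ne_zero {n : ℕ} (k : Fin n) : pivotCount k ≠ 0 := by
  rw [pivotCount, Ne, Finset.sum_eq_zero_iff]
  push Not
  refine ⟨1, Finset.mem_univ _, ?_⟩
  rw [indicator_of_mem]
  · simp
  · simp only [pivotSet, mem_ofPred_eq, Equiv.Perm.coe_one, id_eq, Nat.cast_lt, Fin.lt_def]
    exact ⟨fun _ h => h, fun _ h => h⟩

theorem pivotCount_ne_top {n : ℕ} (k : Fin n) : pivotCount k ≠ ⊤ := by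
  rw [pivotCount, ENNReal.sum_ne_top]
  intro τ _
  by_cases h : (fun i => ((τ i : ℕ) : ℝ)) ∈ pivotSet k <;> simp [h]

/-- A permutation invariant event is, up to a constant, as likely on `pivotSet k` as on the whole
space. -/
theorem measure_inter_pivotSet {n : ℕ} (k : Fin n) {S : Set (Fin n → ℝ)} (hS : MeasurableSet S)
    (hinv : ∀ (τ : Equiv.Perm (Fin n)) x, x ∘ τ ∈ S ↔ x ∈ S) :
    (Fintype.card (Equiv.Perm (Fin n)) : ENNReal) *
        (Measure.pi fun _ : Fin n => unif) (S ∩ pivotSet k) =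
      pivotCount k * (Measure.pi fun _ : Fin n => unif) S := by
  set m := Measure.pi fun _ : Fin n => unif
  -- Double counting: integrate over `S` the number of `τ` with `x ∘ τ ∈ pivotSet k`. By invariance
  -- every `τ` contributes the same measure, while the count is almost everywhere the constant
  -- `pivotCount k`.
  have h1 : ∀ τ : Equiv.Perm (Fin n), ∫⁻ x in S,
      (pivotSet k).indicator (1 : (Fin n → ℝ) → ENNReal) (x ∘ τ) ∂m = m (S ∩ pivotSet k) := by
    intro τ
    rw [← lintegral_indicator hS]
    have : (fun x => S.indicator (fun x => (pivotSet k).indicator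
        (1 : (Fin n → ℝ) → ENNReal) (x ∘ τ)) x) =
        fun x => (S ∩ pivotSet k).indicator (1 : (Fin n → ℝ) → ENNReal) (x ∘ τ) := by
      funext x
      by_cases hx : x ∈ S <;> by_cases hx' : x ∘ τ ∈ pivotSet k <;>
        simp [indicator, hx, hx', hinv]
    rw [this, (measurePreserving_comp_perm unif τ).lintegral_comp
      (measurable_one.indicator (hS.inter (measurableSet_pivotSet k))),
      lintegral_indicator_one (hS.inter (measurableSet_pivotSet k))]
  have h2 : ∫⁻ x in S, ∑ τ : Equiv.Perm (Fin n),
      (pivotSet k).indicator (1 : (Fin n → ℝ) → ENNReal) (x ∘ τ) ∂m = pivotCount k * m S := by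
    rw [← setLIntegral_const]
    refine lintegral_congr_ae (ae_restrict_of_ae ?_)
    filter_upwards [ae_injective_pi_unif n] with x hx
    exact sum_indicator_pivotSet k hx
  rw [← h2, lintegral_finsetSum]
  · simp [h1]
  · intro τ _
    exact (measurable_one.indicator (measurableSet_pivotSet k)).comp (by fun_prop)

/-- The homothety of ratio `v` carries the unit cube onto `(0, v)^ι` and multiplies Lebesgue measure
by a power of `v`, for every set `S`. -/
theorem pi_unif_box_scaling {ι : Type*} [Fintype ι] {v : ℝ} (hv : v ∈ Ioo (0 : ℝ) 1)
    (S : Set (ι → ℝ)) :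
    (Measure.pi fun _ : ι => unif) {w | (∀ i, w i < v) ∧ (fun i => w i / v) ∈ S} =
      ENNReal.ofReal |v ^ Module.finrank ℝ (ι → ℝ)| * (Measure.pi fun _ : ι => unif) S := by
  have hbox : MeasurableSet (univ.pi fun _ : ι => Ioo (0 : ℝ) 1) :=
    MeasurableSet.univ_pi fun _ => measurableSet_Ioo
  rw [pi_unif_eq, Measure.restrict_apply' hbox, Measure.restrict_apply' hbox,
    ← Measure.addHaar_smul]
  congr 1
  ext w
  rw [mem_smul_set_iff_inv_smul_mem₀ hv.1.ne']
  have he : v⁻¹ • w = fun i => w i / v := by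
    funext i
    simp [div_eq_inv_mul]
  rw [he]
  simp only [mem_inter_iff, mem_ofPred_eq, Set.mem_pi, mem_univ, true_implies, mem_Ioo]
  constructor
  · rintro ⟨⟨h1, h2⟩, h3⟩
    exact ⟨h2, fun i => ⟨div_pos (h3 i).1 hv.1, (div_lt_one hv.1).2 (h1 i)⟩⟩
  · rintro ⟨h2, h3⟩
    have h4 : ∀ i, w i < v := fun i => (div_lt_one hv.1).1 (h3 i).2
    refine ⟨⟨h4, h2⟩, fun i => ⟨?_, (h4 i).trans hv.2⟩⟩
    have := mul_pos (h3 i).1 hv.1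
    rwa [div_mul_cancel₀ _ hv.1.ne'] at this

/-- Given that it lies in `pivotSet k`, the first `k` coordinates of a uniform vector divided by
coordinate `k` are again a uniform sample. -/
theorem measure_pivotSet_inter_ratio {n : ℕ} (k : Fin n) {φ : ℝ → ℝ} (hφ : Measurable φ) :
    ∃ C : ENNReal, ∀ B : Set ℝ, MeasurableSet B →
      (Measure.pi fun _ : Fin n => unif)
          ({x | ∑ i ∈ Finset.Iio k, φ (x i / x k) ∈ B} ∩ pivotSet k) =
        C * (Measure.pi fun _ : Fin n => unif) {x | ∑ i ∈ Finset.Iio k, φ (x i) ∈ B} := by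
  classical
  let p : Fin n → Prop := fun i => i < k
  let k' : {i : Fin n // ¬ p i} := ⟨k, lt_irrefl k⟩
  let D : Set ({i : Fin n // ¬ p i} → ℝ) := {y | ∀ i, k < i.1 → y k' < y i}
  have hD : MeasurableSet D := by
    simp only [D, ofPred_forall]
    exact MeasurableSet.iInter fun i => MeasurableSet.iInter fun _ =>
      measurableSet_lt (by fun_prop) (by fun_prop)
  have hmp := measurePreserving_piEquivPiSubtypeProd (fun _ : Fin n => unif) p
  have hsum : ∀ f : Fin n → ℝ, ∑ i ∈ Finset.Iio k, f i = ∑ i : {i : Fin n // p i}, f i := by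
    intro f
    rw [← Finset.sum_subtype (Finset.Iio k) (p := p) (by simp [p])]
  -- Fubini: when coordinate `k` has the value `v`, the earlier coordinates fill `(0, v)^k` and
  -- rescale to the unit cube at the price of `v ^ k`. That price, integrated over the admissible
  -- later coordinates, is the constant, and it does not involve `B`.
  refine ⟨∫⁻ y, D.indicator (fun y => ENNReal.ofReal
    |(y k') ^ Module.finrank ℝ ({i : Fin n // p i} → ℝ)|) y
      ∂(Measure.pi fun _ : {i : Fin n // ¬ p i} => unif), fun B hB => ?_⟩
  let S : Set ({i : Fin n // p i} → ℝ) := {w | ∑ i, φ (w i) ∈ B}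
  have hS : MeasurableSet S := by
    have : Measurable fun w : {i : Fin n // p i} → ℝ => ∑ i, φ (w i) := by fun_prop
    exact this hB
  have hq : (Measure.pi fun _ : Fin n => unif) {x | ∑ i ∈ Finset.Iio k, φ (x i) ∈ B} =
      (Measure.pi fun _ : {i : Fin n // p i} => unif) S := by
    have h1 := hmp.measure_preimage (s := S ×ˢ univ) (hS.prod MeasurableSet.univ).nullMeasurableSet
    rw [Measure.prod_prod, measure_univ, mul_one] at h1
    rw [← h1]
    congr 1
    ext x
    simp only [mem_ofPred_eq, hsum]
    simp [S, MeasurableEquiv.piEquivPiSubtypeProd, Equiv.piEquivPiSubtypeProd]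
  let A : Set (({i : Fin n // p i} → ℝ) × ({i : Fin n // ¬ p i} → ℝ)) :=
    {z | ((∀ i, z.1 i < z.2 k') ∧ (∑ i, φ (z.1 i / z.2 k') ∈ B)) ∧ z.2 ∈ D}
  have hA : MeasurableSet A := by
    simp only [A, ofPred_and, ofPred_forall]
    refine MeasurableSet.inter (MeasurableSet.inter ?_ ?_) ?_
    · exact MeasurableSet.iInter fun i => measurableSet_lt (by fun_prop) (by fun_prop)
    · have : Measurable fun z : ({i : Fin n // p i} → ℝ) × ({i : Fin n // ¬ p i} → ℝ) =>
          ∑ i, φ (z.1 i / z.2 k') := by fun_prop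
      exact this hB
    · exact measurable_snd hD
  have h2 := hmp.measure_preimage (s := A) hA.nullMeasurableSet
  have h3 : (MeasurableEquiv.piEquivPiSubtypeProd (fun _ : Fin n => ℝ) p) ⁻¹' A =
      {x | ∑ i ∈ Finset.Iio k, φ (x i / x k) ∈ B} ∩ pivotSet k := by
    ext x
    simp only [mem_inter_iff, mem_ofPred_eq, hsum, pivotSet]
    simp only [A, D, MeasurableEquiv.piEquivPiSubtypeProd, Equiv.piEquivPiSubtypeProd, k']
    simp only [MeasurableEquiv.coe_mk, Equiv.coe_fn_mk, mem_preimage, mem_ofPred_eq,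
      Subtype.forall]
    constructor
    · rintro ⟨⟨h1, h2⟩, h3⟩
      exact ⟨h2, h1, fun i hi => h3 i hi.not_gt hi⟩
    · rintro ⟨h2, h1, h3⟩
      exact ⟨⟨h1, h2⟩, fun i _ hi => h3 i hi⟩
  rw [← h3, h2, Measure.prod_apply_symm hA, hq, ← lintegral_mul_const]
  · refine lintegral_congr_ae ?_
    have hy : ∀ᵐ y ∂(Measure.pi fun _ : {i : Fin n // ¬ p i} => unif), y k' ∈ Ioo (0 : ℝ) 1 := by
      have h := measurePreserving_eval (fun _ : {i : Fin n // ¬ p i} => unif) k'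
      exact h.quasiMeasurePreserving.ae (ae_restrict_mem measurableSet_Ioo)
    filter_upwards [hy] with y hy
    by_cases hyD : y ∈ D
    · rw [indicator_of_mem hyD]
      rw [← pi_unif_box_scaling hy S]
      congr 1
      ext w
      simp [A, S, hyD]
    · rw [indicator_of_notMem hyD, zero_mul]
      have : (fun w : {i : Fin n // p i} → ℝ => (w, y)) ⁻¹' A = ∅ := by
        ext w
        simp [A, hyD]
      rw [this, measure_empty]
  · exact Measurable.indicator (by fun_prop) hD

/-- Divided by the next order statistic, the `k` smallest of `n` uniform variables have the same
sums `∑ φ` as `k` independent uniform variables. -/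
theorem measure_sum_sortedVec_ratio {n : ℕ} (k : Fin n) {φ : ℝ → ℝ} (hφ : Measurable φ)
    {B : Set ℝ} (hB : MeasurableSet B) :
    (Measure.pi fun _ : Fin n => unif)
        {x | ∑ i ∈ Finset.Iio k, φ (sortedVec x i / sortedVec x k) ∈ B} =
      (Measure.pi fun _ : Fin n => unif) {x | ∑ i ∈ Finset.Iio k, φ (x i) ∈ B} := by
  set m := Measure.pi fun _ : Fin n => unif
  have hT : ∀ B : Set ℝ, MeasurableSet B →
      MeasurableSet {x : Fin n → ℝ |
        ∑ i ∈ Finset.Iio k, φ (sortedVec x i / sortedVec x k) ∈ B} := by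
    intro B hB
    have : Measurable fun x : Fin n → ℝ =>
        ∑ i ∈ Finset.Iio k, φ (sortedVec x i / sortedVec x k) :=
      Finset.measurable_fun_sum _ fun i _ =>
        hφ.comp ((measurable_sortedVec i).div (measurable_sortedVec k))
    exact this hB
  obtain ⟨C, hC⟩ := measure_pivotSet_inter_ratio k hφ
  have key : ∀ B : Set ℝ, MeasurableSet B →
      pivotCount k * m {x | ∑ i ∈ Finset.Iio k, φ (sortedVec x i / sortedVec x k) ∈ B} =
        (Fintype.card (Equiv.Perm (Fin n)) : ENNReal) *
          (C * m {x | ∑ i ∈ Finset.Iio k, φ (x i) ∈ B}) := by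
    intro B hB
    rw [← hC B hB, ← measure_inter_pivotSet k (hT B hB)
      (fun τ x => by simp only [mem_ofPred_eq, sortedVec_comp_perm])]
    congr 2
    ext x
    simp only [mem_inter_iff, mem_ofPred_eq]
    refine and_congr_left fun hx => ?_
    rw [sum_sortedVec_of_mem_pivotSet hx]
  -- Total mass identifies the unknown constant: `B = univ` gives `pivotCount k = n! * C`.
  have h1 := key univ MeasurableSet.univ
  simp only [mem_univ, ofPred_true, measure_univ, mul_one] at h1
  have h2 := key B hB
  rw [← mul_assoc, ← h1] at h2
  exact (ENNReal.mul_right_inj (pivotCount_ne_zero k) (pivotCount_ne_top k)).1 h2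

/-! ### Moments of `-log U` and bounds for the Gamma function -/

/-- The substitution `u = exp (-x)` shows that `-log U` is standard exponential. -/
theorem lintegral_unif_comp_neg_log (g : ℝ → ENNReal) :
    ∫⁻ u, g (-Real.log u) ∂unif = ∫⁻ x in Ioi (0 : ℝ), ENNReal.ofReal (Real.exp (-x)) * g x := by
  have himg : (fun x : ℝ => Real.exp (-x)) '' Ioi 0 = Ioo 0 1 := by
    ext u
    simp only [mem_image, mem_Ioi, mem_Ioo]
    constructor
    · rintro ⟨x, hx, rfl⟩
      exact ⟨Real.exp_pos _, Real.exp_lt_one_iff.2 (by linarith)⟩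
    · rintro ⟨h0, h1⟩
      exact ⟨-Real.log u, by linarith [Real.log_neg h0 h1], by rw [neg_neg, Real.exp_log h0]⟩
  rw [unif, ← himg, lintegral_image_eq_lintegral_abs_deriv_mul (f' := fun x => -Real.exp (-x))
    measurableSet_Ioi]
  · simp
  · intro x _
    have := ((hasDerivAt_neg x).exp).hasDerivWithinAt (s := Ioi 0)
    simpa using this
  · intro x _ y _ h
    simpa using h

theorem lintegral_exp_neg_mul_rpow {γ q : ℝ} (hγ : 0 < γ) (hq : -1 < q) :
    ∫⁻ x in Ioi (0 : ℝ), ENNReal.ofReal (Real.exp (-x)) * ENNReal.ofReal ((γ * x) ^ q) =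
      ENNReal.ofReal (γ ^ q * Real.Gamma (q + 1)) := by
  have hint := (Real.GammaIntegral_convergent (s := q + 1) (by linarith)).const_mul (γ ^ q)
  rw [Real.Gamma_eq_integral (by linarith), ← integral_const_mul,
    ofReal_integral_eq_lintegral_ofReal hint]
  · refine setLIntegral_congr_fun measurableSet_Ioi fun x hx => ?_
    rw [← ENNReal.ofReal_mul (Real.exp_pos _).le, Real.mul_rpow hγ.le (le_of_lt hx)]
    congr 1
    rw [add_sub_cancel_right]
    ring
  · refine (ae_restrict_mem measurableSet_Ioi).mono fun x hx => ?_
    have : (0 : ℝ) < x := hx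
    simp only [Pi.zero_apply]
    positivity

theorem neg_log_nonneg_ae_unif {γ : ℝ} (hγ : 0 < γ) :
    ∀ᵐ u ∂unif, 0 ≤ γ * -Real.log u := by
  refine (ae_restrict_mem measurableSet_Ioo).mono fun u hu => ?_
  have := Real.log_nonpos hu.1.le hu.2.le
  exact mul_nonneg hγ.le (by linarith)

theorem lintegral_unif_rpow {γ q : ℝ} (hγ : 0 < γ) (hq : -1 < q) :
    ∫⁻ u, ENNReal.ofReal ((γ * -Real.log u) ^ q) ∂unif = ENNReal.ofReal (mLim γ q) := by
  rw [lintegral_unif_comp_neg_log (fun x => ENNReal.ofReal ((γ * x) ^ q)),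
    lintegral_exp_neg_mul_rpow hγ hq, mLim]

theorem mLim_pos {γ q : ℝ} (hγ : 0 < γ) (hq : -1 < q) : 0 < mLim γ q :=
  mul_pos (Real.rpow_pos_of_pos hγ _) (Real.Gamma_pos_of_pos (by linarith))

theorem integrable_unif_rpow {γ q : ℝ} (hγ : 0 < γ) (hq : -1 < q) :
    Integrable (fun u => (γ * -Real.log u) ^ q) unif := by
  refine ⟨(by fun_prop : Measurable _).aestronglyMeasurable, ?_⟩
  rw [hasFiniteIntegral_iff_ofReal ((neg_log_nonneg_ae_unif hγ).mono fun u hu =>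
    Real.rpow_nonneg hu _), lintegral_unif_rpow hγ hq]
  exact ENNReal.ofReal_lt_top

theorem integral_unif_rpow {γ q : ℝ} (hγ : 0 < γ) (hq : -1 < q) :
    ∫ u, (γ * -Real.log u) ^ q ∂unif = mLim γ q := by
  rw [integral_eq_lintegral_of_nonneg_ae ((neg_log_nonneg_ae_unif hγ).mono fun u hu =>
    Real.rpow_nonneg hu _) (by fun_prop : Measurable _).aestronglyMeasurable,
    lintegral_unif_rpow hγ hq,
    ENNReal.toReal_ofReal (mLim_pos hγ hq).le]

/-- Shifting the exponential variable by `ε / γ` costs at most a factor `exp (ε / γ)`. -/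
theorem lintegral_unif_shift_rpow_le {γ q ε : ℝ} (hγ : 0 < γ) (hq : -1 < q) (hε : 0 ≤ ε) :
    ∫⁻ u, ENNReal.ofReal ((γ * -Real.log u + ε) ^ q) ∂unif ≤
      ENNReal.ofReal (Real.exp (ε / γ) * mLim γ q) := by
  set c := ε / γ with hc
  have hc0 : 0 ≤ c := by positivity
  have hcε : γ * c = ε := by rw [hc]; field_simp
  let h : ℝ → ENNReal := fun x =>
    ENNReal.ofReal (Real.exp (-x)) * ENNReal.ofReal ((γ * x) ^ q)
  -- Translating by `c` only loses the mass of `h` on `(0, c]`; the weight `exp (-x) = exp c * exp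
  -- (-(x + c))` accounts for the factor `exp c`.
  have hshift : ∫⁻ x in Ioi (0 : ℝ), h (x + c) ≤ ∫⁻ x in Ioi (0 : ℝ), h x := by
    rw [← lintegral_indicator measurableSet_Ioi, ← lintegral_indicator measurableSet_Ioi,
      ← lintegral_add_right_eq_self ((Ioi (0 : ℝ)).indicator h) c]
    refine lintegral_mono fun x => ?_
    by_cases hx : x ∈ Ioi (0 : ℝ)
    · have hx' : x + c ∈ Ioi (0 : ℝ) := by
        have : (0 : ℝ) < x := hx
        exact mem_Ioi.2 (by linarith)
      rw [indicator_of_mem hx, indicator_of_mem hx']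
    · rw [indicator_of_notMem hx]
      exact zero_le
  rw [lintegral_unif_comp_neg_log (fun x => ENNReal.ofReal ((γ * x + ε) ^ q)),
    ENNReal.ofReal_mul (Real.exp_pos _).le]
  calc ∫⁻ x in Ioi (0 : ℝ), ENNReal.ofReal (Real.exp (-x)) * ENNReal.ofReal ((γ * x + ε) ^ q)
      = ∫⁻ x in Ioi (0 : ℝ), ENNReal.ofReal (Real.exp c) * h (x + c) := by
        refine lintegral_congr fun x => ?_
        simp only [h]
        rw [← mul_assoc, ← ENNReal.ofReal_mul (Real.exp_pos c).le, ← Real.exp_add, mul_add, hcε]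
        congr 3
        ring
    _ = ENNReal.ofReal (Real.exp c) * ∫⁻ x in Ioi (0 : ℝ), h (x + c) := by
        rw [lintegral_const_mul']
        exact ENNReal.ofReal_ne_top
    _ ≤ ENNReal.ofReal (Real.exp c) * ENNReal.ofReal (mLim γ q) := by
        refine mul_le_mul_right (hshift.trans (le_of_eq ?_)) _
        rw [lintegral_exp_neg_mul_rpow hγ hq, mLim]

/-- Keep only the range `x > p` of the Gamma integral, where `x ^ p ≥ p ^ p`. -/
theorem rpow_mul_exp_neg_le_Gamma {p : ℝ} (hp : 0 < p) :
    p ^ p * Real.exp (-p) ≤ Real.Gamma (p + 1) := by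
  have hint := Real.GammaIntegral_convergent (s := p + 1) (by linarith)
  rw [Real.Gamma_eq_integral (by linarith)]
  calc p ^ p * Real.exp (-p) = ∫ x in Ioi p, Real.exp (-x) * p ^ p := by
        rw [integral_mul_const, integral_exp_neg_Ioi, mul_comm]
    _ ≤ ∫ x in Ioi p, Real.exp (-x) * x ^ (p + 1 - 1) := by
        refine setIntegral_mono_on ?_ (hint.mono_set (Ioi_subset_Ioi hp.le)) measurableSet_Ioi ?_
        · exact (integrableOn_exp_neg_Ioi p).mul_const _
        · intro x hx
          have : p < x := hx
          rw [add_sub_cancel_right]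
          gcongr
    _ ≤ ∫ x in Ioi (0 : ℝ), Real.exp (-x) * x ^ (p + 1 - 1) := by
        refine setIntegral_mono_set hint ?_ (Ioi_subset_Ioi hp.le).eventuallyLE
        refine (ae_restrict_mem measurableSet_Ioi).mono fun x hx => ?_
        have : (0 : ℝ) < x := hx
        simp only [Pi.zero_apply]
        positivity

/-- A reversed Lyapunov inequality for moments of the exponential law. Split off `x ^ (r p)` and
bound it by `K exp (r x / (1 + r))`, where `K` is the maximum of `x ^ (r p) exp (-r x / (1 + r))`,
attained at `x = b`. What remains is a rescaled Gamma integral, and `rpow_mul_exp_neg_le_Gamma`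
turns `K` back into a power of `Γ(p + 1)`. -/
theorem Gamma_mul_add_one_le {p r : ℝ} (hp : 0 < p) (hr : 0 < r) :
    Real.Gamma ((1 + r) * p + 1) ≤
      (1 + r) ^ ((1 + r) * p + 1) * Real.Gamma (p + 1) ^ (1 + r) := by
  set b := p * (1 + r) with hb
  have hb0 : 0 < b := by positivity
  set K := (b / Real.exp 1) ^ (r * p) with hK
  have hG : 0 < Real.Gamma (p + 1) := Real.Gamma_pos_of_pos (by linarith)
  have hpt : ∀ x : ℝ, 0 < x → x ^ (r * p) ≤ K * Real.exp (r / (1 + r) * x) := by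
    intro x hx
    have h1 : x / b ≤ Real.exp (x / b - 1) := by
      have := Real.add_one_le_exp (x / b - 1)
      linarith
    have h2 : x ≤ b / Real.exp 1 * Real.exp (x / b) := by
      rw [Real.exp_sub] at h1
      rw [div_le_iff₀ hb0] at h1
      calc x ≤ _ := h1
        _ = _ := by ring
    calc x ^ (r * p) ≤ (b / Real.exp 1 * Real.exp (x / b)) ^ (r * p) := by gcongr
      _ = K * Real.exp (r / (1 + r) * x) := by
        rw [Real.mul_rpow (by positivity) (by positivity), ← Real.exp_mul, hK, hb]
        congr 2
        field_simp
  have h1 : Real.Gamma ((1 + r) * p + 1) ≤ K * ((1 + r) ^ (p + 1) * Real.Gamma (p + 1)) := by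
    have h2 := Real.integral_rpow_mul_exp_neg_mul_Ioi (a := p + 1) (r := 1 / (1 + r))
      (by linarith) (by positivity)
    rw [one_div_one_div] at h2
    rw [← h2, ← integral_const_mul, Real.Gamma_eq_integral (by positivity)]
    refine setIntegral_mono_on (Real.GammaIntegral_convergent (by positivity)) ?_
      measurableSet_Ioi ?_
    · refine Integrable.const_mul ?_ _
      have h3 := integrableOn_rpow_mul_exp_neg_mul_rpow (s := p) (p := 1) (b := 1 / (1 + r))
        (by linarith) one_pos (by positivity)
      refine h3.congr_fun (fun x _ => ?_) measurableSet_Ioi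
      simp
    · intro x hx
      have hx : (0 : ℝ) < x := hx
      have hexp : Real.exp (-x) = Real.exp (-(r / (1 + r) * x)) *
          Real.exp (-(1 / (1 + r) * x)) := by
        rw [← Real.exp_add]
        congr 1
        field_simp
        ring
      have hpow : x ^ ((1 + r) * p + 1 - 1) = x ^ p * x ^ (r * p) := by
        rw [← Real.rpow_add hx]
        congr 1
        ring
      rw [hpow, add_sub_cancel_right, hexp]
      calc Real.exp (-(r / (1 + r) * x)) * Real.exp (-(1 / (1 + r) * x)) * (x ^ p * x ^ (r * p))
          ≤ Real.exp (-(r / (1 + r) * x)) * Real.exp (-(1 / (1 + r) * x)) *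
            (x ^ p * (K * Real.exp (r / (1 + r) * x))) := by
            gcongr
            exact hpt x hx
        _ = (Real.exp (-(r / (1 + r) * x)) * Real.exp (r / (1 + r) * x)) *
            (K * (x ^ p * Real.exp (-(1 / (1 + r) * x)))) := by ring
        _ = _ := by rw [← Real.exp_add, neg_add_cancel, Real.exp_zero, one_mul]
  have hK2 : K ≤ (1 + r) ^ (r * p) * Real.Gamma (p + 1) ^ r := by
    have h3 : K = (1 + r) ^ (r * p) * ((p / Real.exp 1) ^ p) ^ r := by
      rw [← Real.rpow_mul (by positivity), mul_comm p r,
        ← Real.mul_rpow (by positivity) (by positivity), hK, hb]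
      congr 1
      ring
    rw [h3]
    gcongr
    rw [Real.div_rpow hp.le (by positivity), ← Real.exp_mul, one_mul, div_eq_mul_inv,
      ← Real.exp_neg]
    exact rpow_mul_exp_neg_le_Gamma hp
  calc Real.Gamma ((1 + r) * p + 1) ≤ K * ((1 + r) ^ (p + 1) * Real.Gamma (p + 1)) := h1
    _ ≤ ((1 + r) ^ (r * p) * Real.Gamma (p + 1) ^ r) *
        ((1 + r) ^ (p + 1) * Real.Gamma (p + 1)) := by gcongr
    _ = _ := by
      rw [Real.rpow_add hG 1 r, Real.rpow_one]
      have : (1 + r) ^ ((1 + r) * p + 1) = (1 + r) ^ (r * p) * (1 + r) ^ (p + 1) := by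
        rw [← Real.rpow_add (by positivity)]
        congr 1
        ring
      rw [this]
      ring

/-- A lower bound for the central binomial coefficient `Γ (2 p + 1) / Γ (p + 1) ^ 2`. -/
theorem four_rpow_mul_Gamma_sq_le {p : ℝ} (hp : 2 ≤ p) :
    4 ^ p * Real.Gamma (p + 1) ^ 2 ≤ √Real.pi * p * Real.Gamma (2 * p + 1) := by
  -- Legendre duplication: `Γ(p + 1/2) Γ(p + 1) = √π 4^(-p) Γ(2p + 1)`. One factor `Γ(p + 1) = p
  -- Γ(p)` is enlarged to `p Γ(p + 1/2)`; `2 ≤ p` places both arguments where `Γ` increases.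
  have h := Real.Gamma_mul_Gamma_add_half (p + 1 / 2)
  have e1 : p + 1 / 2 + 1 / 2 = p + 1 := by ring
  have e2 : 2 * (p + 1 / 2) = 2 * p + 1 := by ring
  have e3 : 1 - (2 * p + 1) = -(2 * p) := by ring
  rw [e1, e2, e3, Real.rpow_neg (by norm_num), Real.rpow_mul (by norm_num)] at h
  norm_num at h
  have h4 : (0 : ℝ) < 4 ^ p := by positivity
  have hG : 0 < Real.Gamma (p + 1) := Real.Gamma_pos_of_pos (by linarith)
  have hmono : Real.Gamma p ≤ Real.Gamma (p + 1 / 2) :=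
    Real.Gamma_strictMonoOn_Ici.monotoneOn (mem_Ici.2 hp) (mem_Ici.2 (by linarith)) (by linarith)
  have hrec : Real.Gamma (p + 1) = p * Real.Gamma p := Real.Gamma_add_one (by linarith)
  calc 4 ^ p * Real.Gamma (p + 1) ^ 2 = 4 ^ p * (p * Real.Gamma p * Real.Gamma (p + 1)) := by
        rw [← hrec]; ring
    _ ≤ 4 ^ p * (p * Real.Gamma (p + 1 / 2) * Real.Gamma (p + 1)) := by gcongr
    _ = 4 ^ p * p * (Real.Gamma (p + 1 / 2) * Real.Gamma (p + 1)) := by ring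
    _ = _ := by
      rw [h]
      field_simp

/-! ### Independent uniform samples -/

/-- `U 0, U 1, …` are independent and uniform on `(0, 1)` under `P`. -/
structure IsUniformSample {Ω : Type*} [MeasurableSpace Ω] (U : ℕ → Ω → ℝ) (P : Measure Ω) :
    Prop where
  measurable : ∀ i, Measurable (U i)
  indep : iIndepFun U P
  law : ∀ i, P.map (U i) = unif

namespace IsUniformSample

variable {Ω : Type*} [MeasurableSpace Ω] {P : Measure Ω} {U : ℕ → Ω → ℝ}

theorem measurePreserving (hU : IsUniformSample U P) (i : ℕ) : MeasurePreserving (U i) P unif :=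
  ⟨hU.measurable i, hU.law i⟩

theorem integral_comp (hU : IsUniformSample U P) (i : ℕ) {f : ℝ → ℝ} (hf : Measurable f) :
    ∫ ω, f (U i ω) ∂P = ∫ u, f u ∂unif := by
  rw [← hU.law i, integral_map (hU.measurable i).aemeasurable hf.aestronglyMeasurable]

theorem measurable_orderStat_comp (hU : IsUniformSample U P) (n i : ℕ) :
    Measurable fun ω => orderStat (fun j => U j ω) n i :=
  (measurable_orderStat n i).comp (measurable_pi_lambda _ hU.measurable)

theorem lintegral_sum (hU : IsUniformSample U P) {g : ℝ → ENNReal} (hg : Measurable g) (k : ℕ) :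
    ∫⁻ ω, ∑ i ∈ Finset.range k, g (U i ω) ∂P = k * ∫⁻ u, g u ∂unif := by
  rw [lintegral_finsetSum (f := fun i ω => g (U i ω)) _ fun i _ => hg.comp (hU.measurable i)]
  simp [(hU.measurePreserving _).lintegral_comp hg]

variable [IsProbabilityMeasure P]

theorem map_eq_pi (hU : IsUniformSample U P) (n : ℕ) :
    P.map (fun ω (i : Fin n) => U i ω) = Measure.pi fun _ => unif := by
  have h := hU.indep.precomp (g := fun i : Fin n => (i : ℕ)) Fin.val_injective
  have h' := (iIndepFun_iff_map_fun_eq_pi_map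
    fun i : Fin n => (hU.measurable i).aemeasurable).1 h
  simpa only [hU.law] using h'

/-- Divided by the next order statistic, the `k` smallest of `n` uniform variables have the same
sums `∑ φ` as `k` independent uniform variables. -/
theorem map_sum_orderStat_ratio (hU : IsUniformSample U P) {n k : ℕ} (hk : k < n) {φ : ℝ → ℝ}
    (hφ : Measurable φ) :
    P.map (fun ω => ∑ i ∈ Finset.Icc 1 k, φ (orderStat (fun j => U j ω) n i /
        orderStat (fun j => U j ω) n (k + 1))) =
      P.map (fun ω => ∑ i ∈ Finset.range k, φ (U i ω)) := by
  have hm1 : Measurable fun ω => ∑ i ∈ Finset.Icc 1 k, φ (orderStat (fun j => U j ω) n i /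
      orderStat (fun j => U j ω) n (k + 1)) :=
    Finset.measurable_fun_sum _ fun i _ => hφ.comp
      ((hU.measurable_orderStat_comp n i).div (hU.measurable_orderStat_comp n (k + 1)))
  have hm2 : Measurable fun ω => ∑ i ∈ Finset.range k, φ (U i ω) :=
    Finset.measurable_fun_sum _ fun i _ => hφ.comp (hU.measurable i)
  have hmU : Measurable fun ω (i : Fin n) => U i ω :=
    measurable_pi_lambda _ fun i => hU.measurable i
  let K : Fin n := ⟨k, hk⟩
  ext B hB
  rw [Measure.map_apply hm1 hB, Measure.map_apply hm2 hB]
  have h := measure_sum_sortedVec_ratio K hφ hB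
  rw [← hU.map_eq_pi n, Measure.map_apply hmU, Measure.map_apply hmU] at h
  · convert! h using 2
    · ext ω
      have h1 := sum_Icc_orderStat (fun j => U j ω) K
        (fun z => φ (z / orderStat (fun j => U j ω) n (k + 1)))
      have h2 := orderStat_eq_sortedVec (fun j => U j ω) K
      simp only [mem_preimage, mem_ofPred_eq]
      rw [show k = (K : ℕ) from rfl, h1, h2]
    · ext ω
      simp only [mem_preimage, mem_ofPred_eq]
      have h3 : ∑ i ∈ Finset.range k, φ (U i ω) = ∑ i ∈ Finset.Iio K, φ (U i ω) := by
        symm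
        refine Finset.sum_bij (fun i _ => (i : ℕ)) ?_ (fun i _ j _ h => Fin.ext h) ?_
          (fun i _ => rfl)
        · intro i hi
          rw [Finset.mem_Iio, Fin.lt_def] at hi
          exact Finset.mem_range.2 hi
        · intro b hb
          rw [Finset.mem_range] at hb
          exact ⟨⟨b, hb.trans hk⟩, by rw [Finset.mem_Iio, Fin.lt_def]; exact hb, rfl⟩
      rw [h3]
  · have : Measurable fun x : Fin n → ℝ => ∑ i ∈ Finset.Iio K, φ (x i) := by fun_prop
    exact this hB
  · have : Measurable fun x : Fin n → ℝ =>
        ∑ i ∈ Finset.Iio K, φ (sortedVec x i / sortedVec x K) :=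
      Finset.measurable_fun_sum _ fun i _ =>
        hφ.comp ((measurable_sortedVec i).div (measurable_sortedVec K))
    exact this hB

/-- Chebyshev's inequality for a function of a uniform sample. -/
theorem measure_abs_sum_sub_ge_le (hU : IsUniformSample U P) {f : ℝ → ℝ} (hf : Measurable f)
    (hf2 : MemLp f 2 unif) (k : ℕ) {c : ℝ} (hc : 0 < c) :
    P {ω | c ≤ |∑ i ∈ Finset.range k, f (U i ω) - k * ∫ u, f u ∂unif|} ≤
      ENNReal.ofReal (k * (∫ u, f u ^ 2 ∂unif) / c ^ 2) := by
  let X : ℕ → Ω → ℝ := fun i ω => f (U i ω)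
  have hX : ∀ i, MemLp (X i) 2 P := fun i => hf2.comp_measurePreserving (hU.measurePreserving i)
  have hS : MemLp (∑ i ∈ Finset.range k, X i) 2 P := memLp_finsetSum' _ fun i _ => hX i
  have hind : iIndepFun X P := hU.indep.comp (fun _ => f) fun _ => hf
  have hvar : Var[∑ i ∈ Finset.range k, X i; P] ≤ k * ∫ u, f u ^ 2 ∂unif := by
    rw [IndepFun.variance_sum (fun i _ => hX i)
      (fun i _ j _ hij => hind.indepFun hij)]
    calc ∑ i ∈ Finset.range k, Var[X i; P] ≤ ∑ i ∈ Finset.range k, ∫ u, f u ^ 2 ∂unif := by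
          refine Finset.sum_le_sum fun i _ => ?_
          refine (variance_le_expectation_sq (hX i).1).trans (le_of_eq ?_)
          exact hU.integral_comp i (hf.pow_const 2)
      _ = _ := by simp
  have hmean : ∫ ω, (∑ i ∈ Finset.range k, X i) ω ∂P = k * ∫ u, f u ∂unif := by
    simp only [Finset.sum_apply]
    rw [integral_finsetSum _ fun i _ => (hX i).integrable (by norm_num)]
    simp [X, hU.integral_comp _ hf]
  have h := meas_ge_le_variance_div_sq hS hc
  rw [hmean] at h
  simp only [Finset.sum_apply] at h
  refine h.trans (ENNReal.ofReal_le_ofReal ?_)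
  gcongr

/-- Weak law of large numbers with a rate, for a function with mean `1` and a finite moment of order
`1 + r`. -/
theorem measure_average_sub_one_ge_le (hU : IsUniformSample U P) {f : ℝ → ℝ} (hf : Measurable f)
    (hf0 : ∀ u, 0 ≤ f u) (hfi : Integrable f unif) (hf1 : ∫ u, f u ∂unif = 1) {r : ℝ}
    (hr : 0 < r) (hr1 : r ≤ 1) (hfr : Integrable (fun u => f u ^ (1 + r)) unif) {k : ℕ}
    (hk : 0 < k) {ε : ℝ} (hε : 0 < ε)
    (hsmall : (∫ u, f u ^ (1 + r) ∂unif) / (k : ℝ) ^ r ≤ ε / 2) :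
    P {ω | ε ≤ |1 / (k : ℝ) * ∑ i ∈ Finset.range k, f (U i ω) - 1|} ≤
      ENNReal.ofReal ((1 + 4 / ε ^ 2) * ((∫ u, f u ^ (1 + r) ∂unif) / (k : ℝ) ^ r)) := by
  set c := ∫ u, f u ^ (1 + r) ∂unif with hc
  have hk0 : (0 : ℝ) < k := Nat.cast_pos.2 hk
  have hc0 : 0 ≤ c := integral_nonneg fun u => Real.rpow_nonneg (hf0 u) _
  set b : ℝ := (k : ℝ) with hb
  have hbr : 0 < b ^ r := Real.rpow_pos_of_pos hk0 _
  -- Truncation at level `k`. With `c` the moment of order `1 + r`, a summand exceeds `k` with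
  -- probability at most `c / k^(1+r)`, the truncated mean is off by at most `c / k^r`, and the
  -- truncated second moment is at most `k^(1-r) c`.
  let s : Set ℝ := {u | f u ≤ b}
  have hs : MeasurableSet s := measurableSet_le hf measurable_const
  let g : ℝ → ℝ := s.indicator f
  have hg : Measurable g := hf.indicator hs
  have hg0 : ∀ u, 0 ≤ g u := fun u => indicator_nonneg (fun u _ => hf0 u) u
  have hgf : ∀ u, g u ≤ f u := fun u => indicator_le_self' (fun u _ => hf0 u) u
  have hgb : ∀ u, g u ≤ b := fun u => by
    by_cases hu : u ∈ s
    · simp only [g, indicator_of_mem hu]; exact hu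
    · simp only [g, indicator_of_notMem hu]; exact hk0.le
  have hg2 : MemLp g 2 unif := MemLp.of_bound hg.aestronglyMeasurable b
    (Eventually.of_forall fun u => by rw [Real.norm_of_nonneg (hg0 u)]; exact hgb u)
  have hgsq : ∀ u, g u ^ 2 ≤ b ^ (1 - r) * f u ^ (1 + r) := by
    intro u
    rcases (hg0 u).eq_or_lt with h | h
    · rw [← h, zero_pow two_ne_zero]
      exact mul_nonneg (Real.rpow_nonneg hk0.le _) (Real.rpow_nonneg (hf0 u) _)
    · have e : g u ^ 2 = g u ^ (1 - r) * g u ^ (1 + r) := by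
        rw [← Real.rpow_add h, ← Real.rpow_natCast]
        congr 1
        push_cast
        ring
      rw [e]
      exact mul_le_mul (Real.rpow_le_rpow h.le (hgb u) (by linarith))
        (Real.rpow_le_rpow h.le (hgf u) (by linarith)) (by positivity) (by positivity)
  have hI2 : ∫ u, g u ^ 2 ∂unif ≤ b ^ (1 - r) * c := by
    rw [hc, ← integral_const_mul]
    exact integral_mono hg2.integrable_sq (hfr.const_mul _) hgsq
  have htail : ∀ u, f u - g u ≤ f u ^ (1 + r) / b ^ r := by
    intro u
    by_cases hu : u ∈ s
    · simp only [g, indicator_of_mem hu, sub_self]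
      have := Real.rpow_nonneg (hf0 u) (1 + r)
      positivity
    · simp only [g, indicator_of_notMem hu, sub_zero]
      have hu' : b < f u := not_le.1 hu
      have hfu : 0 < f u := hk0.trans hu'
      rw [le_div_iff₀ hbr, Real.rpow_add hfu, Real.rpow_one]
      gcongr
  have hgi : Integrable g unif := hfi.indicator hs
  have hI1 : 1 - ∫ u, g u ∂unif ≤ c / b ^ r := by
    rw [← hf1, ← integral_sub hfi hgi, hc, ← integral_div]
    exact integral_mono (hfi.sub hgi) (hfr.div_const _) htail
  have hI1' : ∫ u, g u ∂unif ≤ 1 := by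
    rw [← hf1]
    exact integral_mono hgi hfi hgf
  have hlarge : unif sᶜ ≤ ENNReal.ofReal (c / b ^ (1 + r)) := by
    have h := meas_ge_le_lintegral_div (μ := unif) (f := fun u => ENNReal.ofReal (f u ^ (1 + r)))
      (by fun_prop) (ε := ENNReal.ofReal (b ^ (1 + r)))
      (by simpa using Real.rpow_pos_of_pos hk0 (1 + r)) ENNReal.ofReal_ne_top
    rw [← ofReal_integral_eq_lintegral_ofReal hfr
      (Eventually.of_forall fun u => Real.rpow_nonneg (hf0 u) _),
      ← ENNReal.ofReal_div_of_pos (Real.rpow_pos_of_pos hk0 _)] at h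
    refine (measure_mono fun u hu => ?_).trans h
    have hu' : b < f u := not_le.1 hu
    exact ENNReal.ofReal_le_ofReal (Real.rpow_le_rpow hk0.le hu'.le (by linarith))
  -- If no summand is truncated, the bias of the mean uses up at most `ε / 2`, so the truncated sum
  -- must fluctuate by the other half.
  have hsub : {ω | ε ≤ |1 / b * ∑ i ∈ Finset.range k, f (U i ω) - 1|} ⊆
      (⋃ i ∈ Finset.range k, U i ⁻¹' sᶜ) ∪
        {ω | b * (ε / 2) ≤ |∑ i ∈ Finset.range k, g (U i ω) - k * ∫ u, g u ∂unif|} := by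
    intro ω hω
    rw [mem_union]
    by_contra hcon
    push Not at hcon
    obtain ⟨h1, h2⟩ := hcon
    have hfg : ∑ i ∈ Finset.range k, f (U i ω) = ∑ i ∈ Finset.range k, g (U i ω) := by
      refine Finset.sum_congr rfl fun i hi => ?_
      have : U i ω ∈ s := by
        by_contra hns
        exact h1 (mem_biUnion (x := i) (by simpa using hi) hns)
      simp only [g, indicator_of_mem this]
    simp only [mem_ofPred_eq, not_le] at h2 hω
    rw [hfg] at hω
    have e : 1 / b * ∑ i ∈ Finset.range k, g (U i ω) - 1 =
        1 / b * (∑ i ∈ Finset.range k, g (U i ω) - k * ∫ u, g u ∂unif) +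
          (∫ u, g u ∂unif - 1) := by
      rw [← hb]
      field_simp
      ring
    rw [e] at hω
    have h3 := abs_add_le (1 / b * (∑ i ∈ Finset.range k, g (U i ω) - k * ∫ u, g u ∂unif))
      (∫ u, g u ∂unif - 1)
    have h4 : |∫ u, g u ∂unif - 1| ≤ ε / 2 := by
      rw [abs_sub_comm, abs_of_nonneg (by linarith)]
      linarith
    have h5 : |1 / b * (∑ i ∈ Finset.range k, g (U i ω) - k * ∫ u, g u ∂unif)| < ε / 2 := by
      rw [abs_mul, abs_of_pos (by positivity), one_div, inv_mul_lt_iff₀ hk0]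
      exact h2
    linarith
  refine (measure_mono hsub).trans ((measure_union_le _ _).trans ?_)
  have hA : P (⋃ i ∈ Finset.range k, U i ⁻¹' sᶜ) ≤ ENNReal.ofReal (c / b ^ r) := by
    refine (measure_biUnion_finset_le _ _).trans ?_
    simp only [(hU.measurePreserving _).measure_preimage hs.compl.nullMeasurableSet,
      Finset.sum_const, Finset.card_range, nsmul_eq_mul]
    calc (k : ENNReal) * unif sᶜ ≤ ENNReal.ofReal b * ENNReal.ofReal (c / b ^ (1 + r)) := by
          rw [hb, ENNReal.ofReal_natCast]
          gcongr
      _ = ENNReal.ofReal (c / b ^ r) := by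
          rw [← ENNReal.ofReal_mul hk0.le, Real.rpow_add hk0, Real.rpow_one]
          congr 1
          field_simp
  have hB := hU.measure_abs_sum_sub_ge_le hg hg2 k (c := b * (ε / 2)) (by positivity)
  calc _ ≤ ENNReal.ofReal (c / b ^ r) +
        ENNReal.ofReal (k * (∫ u, g u ^ 2 ∂unif) / (b * (ε / 2)) ^ 2) := add_le_add hA hB
    _ ≤ ENNReal.ofReal (c / b ^ r) + ENNReal.ofReal (4 / ε ^ 2 * (c / b ^ r)) := by
        gcongr
        calc b * (∫ u, g u ^ 2 ∂unif) / (b * (ε / 2)) ^ 2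
            ≤ b * (b ^ (1 - r) * c) / (b * (ε / 2)) ^ 2 := by gcongr
          _ = 4 / ε ^ 2 * (c / b ^ r) := by
            rw [Real.rpow_sub hk0, Real.rpow_one]
            field_simp
            norm_num
    _ = _ := by
        rw [← ENNReal.ofReal_add (by positivity) (by positivity)]
        congr 1
        ring

end IsUniformSample

/-! ### Central limit theorem for row-wise independent functions of a uniform sample -/

/-- Interpolation between the cubic Taylor remainder for `|y| ≤ 1`, where `|y|^3 ≤ |y|^(2+s)`, and
the termwise quadratic bound for `|y| > 1`. -/
theorem norm_exp_mul_I_sub_taylor_le (y : ℝ) {s : ℝ} (hs : 0 < s) (hs1 : s ≤ 1) :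
    ‖Complex.exp (y * Complex.I) - 1 - y * Complex.I + y ^ 2 / 2‖ ≤ 4 * |y| ^ (2 + s) := by
  rcases le_or_gt |y| 1 with hy | hy
  · have h := Complex.norm_exp_sub_sum_le_norm_mul_exp (y * Complex.I) 3
    have e : Complex.exp (y * Complex.I) -
        ∑ m ∈ Finset.range 3, (y * Complex.I : ℂ) ^ m / (m.factorial : ℂ) =
        Complex.exp (y * Complex.I) - 1 - y * Complex.I + y ^ 2 / 2 := by
      simp [Finset.sum_range_succ, mul_pow, Nat.factorial]
      ring
    have hn : ‖(y : ℂ) * Complex.I‖ = |y| := by simp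
    rw [e, hn] at h
    have h1 : Real.exp |y| ≤ 3 := by
      have h3 := Real.exp_one_lt_d9
      have := Real.exp_le_exp.2 hy
      linarith
    have h2 : |y| ^ 3 ≤ |y| ^ (2 + s) := by
      rcases (abs_nonneg y).eq_or_lt with h0 | h0
      · rw [← h0, Real.zero_rpow (by linarith)]
        norm_num
      · rw [← Real.rpow_natCast]
        exact Real.rpow_le_rpow_of_exponent_ge h0 hy (by push_cast; linarith)
    calc _ ≤ |y| ^ 3 * Real.exp |y| := h
      _ ≤ |y| ^ (2 + s) * 3 := by gcongr
      _ ≤ 4 * |y| ^ (2 + s) := by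
        have : 0 ≤ |y| ^ (2 + s) := by positivity
        linarith
  · have h1 : ‖Complex.exp (y * Complex.I) - 1 - y * Complex.I + y ^ 2 / 2‖ ≤
        1 + 1 + |y| + |y| ^ 2 / 2 := by
      refine (norm_add_le _ _).trans (add_le_add ((norm_sub_le _ _).trans (add_le_add
        ((norm_sub_le _ _).trans (add_le_add (Complex.norm_exp_ofReal_mul_I y).le ?_)) ?_)) ?_)
      · simp
      · simp
      · simp
    have h2 : |y| ^ 2 ≤ |y| ^ (2 + s) := by
      rw [← Real.rpow_natCast]
      exact Real.rpow_le_rpow_of_exponent_le hy.le (by push_cast; linarith)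
    nlinarith

theorem norm_charFun_map_sub_le {f : ℝ → ℝ} (hf : Measurable f) {μ : Measure ℝ}
    [IsProbabilityMeasure μ] (h0 : ∫ u, f u ∂μ = 0)
    (h1 : ∫ u, f u ^ 2 ∂μ = 1) (hf2 : MemLp f 2 μ) {s : ℝ} (hs : 0 < s) (hs1 : s ≤ 1)
    (hfs : Integrable (fun u => |f u| ^ (2 + s)) μ) (t : ℝ) :
    ‖charFun (μ.map f) t - (1 - t ^ 2 / 2)‖ ≤ 4 * |t| ^ (2 + s) * ∫ u, |f u| ^ (2 + s) ∂μ := by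
  have hfi : Integrable f μ := hf2.integrable (by norm_num)
  have hsq : Integrable (fun u => f u ^ 2) μ := hf2.integrable_sq
  have hexp : Integrable (fun u => Complex.exp (t * f u * Complex.I)) μ := by
    refine Integrable.of_bound (by fun_prop) 1 (Eventually.of_forall fun u => ?_)
    rw [← Complex.ofReal_mul, Complex.norm_exp_ofReal_mul_I]
  have hfiC : Integrable (fun u => (t : ℂ) * f u * Complex.I) μ :=
    (hfi.ofReal.const_mul _).mul_const _
  have hsqC : Integrable (fun u => ((t : ℂ) * f u) ^ 2 / 2) μ := by
    have := (hsq.ofReal (𝕜 := ℂ)).const_mul ((t : ℂ) ^ 2 / 2)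
    refine this.congr (Eventually.of_forall fun u => ?_)
    simp only [Complex.coe_algebraMap, RCLike.ofReal_pow]
    ring
  have e : charFun (μ.map f) t - (1 - t ^ 2 / 2) = ∫ u, (Complex.exp ((t * f u : ℝ) * Complex.I) -
      1 - (t * f u : ℝ) * Complex.I + (t * f u : ℝ) ^ 2 / 2) ∂μ := by
    rw [charFun_apply_real, integral_map hf.aemeasurable (by fun_prop)]
    push_cast
    have hE1 : Integrable (fun u => Complex.exp (t * f u * Complex.I) - 1) μ :=
      hexp.sub (integrable_const 1)
    have hE2 : Integrable (fun u => Complex.exp (t * f u * Complex.I) - 1 -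
        t * f u * Complex.I) μ := hE1.sub hfiC
    rw [integral_add hE2 hsqC, integral_sub hE1 hfiC, integral_sub hexp (integrable_const 1)]
    have i1 : ∫ u, (t : ℂ) * f u * Complex.I ∂μ = 0 := by
      rw [integral_mul_const, integral_const_mul, integral_complex_ofReal, h0]
      simp
    have i2 : ∫ u, ((t : ℂ) * f u) ^ 2 / 2 ∂μ = (t : ℂ) ^ 2 / 2 := by
      simp_rw [mul_pow, ← Complex.ofReal_pow]
      rw [integral_div, integral_const_mul, integral_complex_ofReal, h1]
      simp
    rw [i1, i2]
    simp
    ring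
  rw [e, ← integral_const_mul]
  refine (norm_integral_le_of_norm_le (hfs.const_mul (4 * |t| ^ (2 + s)))
    (Eventually.of_forall fun u => ?_))
  have := norm_exp_mul_I_sub_taylor_le (t * f u) hs hs1
  rw [abs_mul, Real.mul_rpow (abs_nonneg _) (abs_nonneg _), ← mul_assoc] at this
  exact this

theorem norm_pow_sub_pow_le_mul {a b : ℂ} (ha : ‖a‖ ≤ 1) (hb : ‖b‖ ≤ 1) (n : ℕ) :
    ‖a ^ n - b ^ n‖ ≤ n * ‖a - b‖ := by
  induction n with
  | zero => simp
  | succ n ih =>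
    have e : a ^ (n + 1) - b ^ (n + 1) = a ^ n * (a - b) + (a ^ n - b ^ n) * b := by ring
    rw [e]
    refine (norm_add_le _ _).trans ?_
    rw [norm_mul, norm_mul, norm_pow]
    have h1 : ‖a‖ ^ n * ‖a - b‖ ≤ 1 * ‖a - b‖ := by
      gcongr
      exact pow_le_one₀ (norm_nonneg _) ha
    have h2 : ‖a ^ n - b ^ n‖ * ‖b‖ ≤ (n * ‖a - b‖) * 1 := by gcongr
    push_cast
    linarith

/-- Lyapunov's theorem for triangular arrays. The characteristic function of one summand and `exp
(-t²/(2k))` both agree with `1 - t²/(2k)` up to `o(1/k)`, and passing to `k`-th powers of numbers in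
the unit disc multiplies the gap by at most `k`. -/
theorem tendsto_charFun_pow_of_moment {μ : Measure ℝ} [IsProbabilityMeasure μ] {f : ℕ → ℝ → ℝ}
    (hf : ∀ n, Measurable (f n)) {k : ℕ → ℕ} (hk : Tendsto k atTop atTop) {s : ℝ} (hs : 0 < s)
    (hs1 : s ≤ 1)
    (h : ∀ᶠ n in atTop, ∫ u, f n u ∂μ = 0 ∧ ∫ u, f n u ^ 2 ∂μ = 1 ∧ MemLp (f n) 2 μ ∧
      Integrable (fun u => |f n u| ^ (2 + s)) μ)
    (hc : Tendsto (fun n => (∫ u, |f n u| ^ (2 + s) ∂μ) / (k n : ℝ) ^ (s / 2)) atTop (𝓝 0))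
    (t : ℝ) :
    Tendsto (fun n => charFun (μ.map (f n)) ((√(k n : ℝ))⁻¹ * t) ^ k n) atTop
      (𝓝 (Complex.exp (-(t ^ 2) / 2))) := by
  have hk' : Tendsto (fun n => (k n : ℝ)) atTop atTop := tendsto_natCast_atTop_atTop.comp hk
  rw [tendsto_iff_norm_sub_tendsto_zero]
  have hlim : Tendsto (fun n => 4 * |t| ^ (2 + s) * ((∫ u, |f n u| ^ (2 + s) ∂μ) /
      (k n : ℝ) ^ (s / 2)) + (t ^ 2 / 2) ^ 2 / k n) atTop (𝓝 0) := by
    have := (hc.const_mul (4 * |t| ^ (2 + s))).add (hk'.const_div_atTop ((t ^ 2 / 2) ^ 2))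
    simpa using this
  refine squeeze_zero' (Eventually.of_forall fun n => norm_nonneg _) ?_ hlim
  filter_upwards [h, hk'.eventually_ge_atTop 1, hk'.eventually_ge_atTop (t ^ 2 / 2)]
    with n ⟨h0, h1, h2, h3⟩ hk1 hkt
  set K : ℝ := (k n : ℝ) with hK
  have hK0 : 0 < K := by linarith
  set b : ℂ := Complex.exp (-(t ^ 2) / 2 / K) with hb
  have hbk : Complex.exp (-(t ^ 2) / 2) = b ^ k n := by
    rw [hb, ← Complex.exp_nat_mul]
    congr 1
    have : (K : ℂ) ≠ 0 := by exact_mod_cast hK0.ne'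
    rw [hK, Complex.ofReal_natCast] at this ⊢
    field_simp
  have hbr : b = ((Real.exp (-(t ^ 2) / 2 / K) : ℝ) : ℂ) := by rw [hb]; push_cast; rfl
  have hb1 : ‖b‖ ≤ 1 := by
    rw [hbr, Complex.norm_real, Real.norm_of_nonneg (Real.exp_pos _).le, Real.exp_le_one_iff]
    have : 0 ≤ t ^ 2 / 2 / K := by positivity
    rw [neg_div, neg_div]
    linarith
  have hP : IsProbabilityMeasure (μ.map (f n)) :=
    Measure.isProbabilityMeasure_map (hf n).aemeasurable
  have hsq : (((√K)⁻¹ * t : ℝ)) ^ 2 = t ^ 2 / K := by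
    rw [mul_pow, inv_pow, Real.sq_sqrt hK0.le]
    field_simp
  have hsqrt : |(√K)⁻¹ * t| ^ (2 + s) = |t| ^ (2 + s) / (K * K ^ (s / 2)) := by
    rw [abs_mul, Real.mul_rpow (abs_nonneg _) (abs_nonneg _),
      abs_of_nonneg (inv_nonneg.2 (Real.sqrt_nonneg _)), Real.inv_rpow (Real.sqrt_nonneg _),
      Real.sqrt_eq_rpow, ← Real.rpow_mul hK0.le]
    have : 1 / 2 * (2 + s) = 1 + s / 2 := by ring
    rw [this, Real.rpow_add hK0, Real.rpow_one]
    field_simp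
  have hA := norm_charFun_map_sub_le (hf n) h0 h1 h2 hs hs1 h3 ((√K)⁻¹ * t)
  have hcast : (((√K)⁻¹ * t : ℝ) : ℂ) ^ 2 = t ^ 2 / K := by
    rw [← Complex.ofReal_pow, hsq]
    push_cast
    rfl
  rw [hsqrt, hcast] at hA
  have hB : ‖b - 1 - (-(t ^ 2) / 2 / K : ℂ)‖ ≤ (t ^ 2 / 2 / K) ^ 2 := by
    have hn : ‖(-(t ^ 2) / 2 / K : ℂ)‖ = t ^ 2 / 2 / K := by
      have : (-(t ^ 2) / 2 / K : ℂ) = ((-(t ^ 2 / 2 / K) : ℝ) : ℂ) := by push_cast; ring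
      rw [this, Complex.norm_real, norm_neg, Real.norm_of_nonneg (by positivity)]
    have h4 := Complex.norm_exp_sub_one_sub_id_le (x := (-(t ^ 2) / 2 / K : ℂ))
      (by rw [hn]; exact div_le_one_of_le₀ hkt hK0.le)
    rwa [hn] at h4
  rw [hbk]
  calc _ ≤ K * ‖charFun (μ.map (f n)) ((√K)⁻¹ * t) - b‖ :=
        norm_pow_sub_pow_le_mul (norm_charFun_le_one _) hb1 (k n)
    _ ≤ K * (4 * (|t| ^ (2 + s) / (K * K ^ (s / 2))) * (∫ u, |f n u| ^ (2 + s) ∂μ) +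
        (t ^ 2 / 2 / K) ^ 2) := by
      gcongr
      have e : charFun (μ.map (f n)) ((√K)⁻¹ * t) - b =
          (charFun (μ.map (f n)) ((√K)⁻¹ * t) - (1 - t ^ 2 / K / 2)) -
            (b - 1 - (-(t ^ 2) / 2 / K : ℂ)) := by ring
      rw [e]
      exact (norm_sub_le _ _).trans (add_le_add hA hB)
    _ = _ := by
      have : 0 < K ^ (s / 2) := Real.rpow_pos_of_pos hK0 _
      field_simp

theorem IsUniformSample.charFun_map_sum {Ω : Type*} [MeasurableSpace Ω] {P : Measure Ω}
    [IsProbabilityMeasure P] {U : ℕ → Ω → ℝ} (hU : IsUniformSample U P) {f : ℝ → ℝ}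
    (hf : Measurable f) (k : ℕ) (c t : ℝ) :
    charFun (P.map fun ω => c * ∑ i ∈ Finset.range k, f (U i ω)) t =
      charFun (unif.map f) (c * t) ^ k := by
  have hm : ∀ i, Measurable fun ω => f (U i ω) := fun i => hf.comp (hU.measurable i)
  have hind : iIndepFun (fun i ω => f (U i ω)) P := hU.indep.comp (fun _ => f) fun _ => hf
  rw [charFun_map_mul_comp (Finset.measurable_fun_sum _ fun i _ => hm i).aemeasurable,
    (hind.restrict _).charFun_map_fun_finsetSum_eq_prod fun i _ => (hm i).aemeasurable]
  have : ∀ i, P.map (fun ω => f (U i ω)) = unif.map f := fun i => by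
    rw [← hU.law i, Measure.map_map hf (hU.measurable i)]
    rfl
  simp [this]

/-! ### Quantiles and the second-order condition -/

/-- Inside `(0, 1)` the defining sets are nonempty and bounded below, so `sInf` does not take its
default value. -/
theorem quantile_mono {ν : Measure ℝ} [IsProbabilityMeasure ν] {s t : ℝ} (hs : 0 < s)
    (hst : s ≤ t) (ht : t < 1) : quantile ν s ≤ quantile ν t := by
  refine csInf_le_csInf ?_ ?_ fun x hx => hst.trans hx
  · obtain ⟨b, hb⟩ := ((tendsto_cdf_atBot ν).eventually_lt_const hs).exists
    refine ⟨b, fun x hx => ?_⟩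
    by_contra hc
    have h1 : s ≤ cdf ν x := hx
    have := monotone_cdf ν (not_le.1 hc).le
    linarith
  · obtain ⟨b, hb⟩ := ((tendsto_cdf_atTop ν).eventually_const_lt ht).exists
    exact ⟨b, hb.le⟩

/-- The function is monotone on `(0, 1)`, constant on `(-∞, 0]` and on `(1, ∞)` where the defining
set is everything or empty, and `1` is a single point. -/
theorem measurable_quantile (ν : Measure ℝ) [IsProbabilityMeasure ν] :
    Measurable (quantile ν) := by
  have h0 : ∀ s, s ≤ 0 → quantile ν s = quantile ν 0 := by
    intro s hs
    have : ∀ s, s ≤ 0 → {x : ℝ | s ≤ cdf ν x} = univ := fun s hs =>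
      eq_univ_of_forall fun x => hs.trans (cdf_nonneg ν x)
    simp only [quantile, this s hs, this 0 le_rfl]
  have h1 : ∀ s, 1 < s → quantile ν s = quantile ν 2 := by
    intro s hs
    have : ∀ s, 1 < s → {x : ℝ | s ≤ cdf ν x} = ∅ := fun s hs =>
      eq_empty_of_forall_notMem fun x hx => absurd (hs.trans_le hx) (not_lt.2 (cdf_le_one ν x))
    simp only [quantile, this s hs, this 2 one_lt_two]
  have hmid : Measurable (fun s : Ioo (0 : ℝ) 1 => quantile ν s) :=
    Monotone.measurable fun s t hst => quantile_mono s.2.1 hst t.2.2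
  have key : quantile ν = (Ioo (0 : ℝ) 1).piecewise (quantile ν)
      ((Iic (0 : ℝ)).piecewise (fun _ => quantile ν 0)
        (({1} : Set ℝ).piecewise (fun _ => quantile ν 1) fun _ => quantile ν 2)) := by
    funext s
    by_cases hs : s ∈ Ioo (0 : ℝ) 1
    · rw [piecewise_eq_of_mem _ _ _ hs]
    rw [piecewise_eq_of_notMem _ _ _ hs]
    by_cases hs0 : s ∈ Iic (0 : ℝ)
    · rw [piecewise_eq_of_mem _ _ _ hs0, h0 s hs0]
    rw [piecewise_eq_of_notMem _ _ _ hs0]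
    by_cases hs1 : s ∈ ({1} : Set ℝ)
    · rw [piecewise_eq_of_mem _ _ _ hs1, mem_singleton_iff.1 hs1]
    rw [piecewise_eq_of_notMem _ _ _ hs1]
    refine h1 s ?_
    have h2 : 0 < s := not_le.1 hs0
    have h3 : 1 ≤ s := not_lt.1 fun h => hs ⟨h2, h⟩
    exact lt_of_le_of_ne h3 fun h => hs1 h.symm
  rw [key]
  refine measurable_of_restrict_of_restrict_compl (s := Ioo (0 : ℝ) 1) measurableSet_Ioo ?_ ?_
  · rw [domRestrict_piecewise]
    exact hmid
  · rw [domRestrict_piecewise_compl]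
    exact ((measurable_const.piecewise measurableSet_Iic
      (measurable_const.piecewise (measurableSet_singleton 1) measurable_const))).comp
        measurable_subtype_coe

theorem exists_abs_sub_le_of_uniformSecondOrder {ℓ a : ℝ → ℝ} (h : UniformSecondOrder ℓ a)
    (ha : ∀ᶠ v in 𝓝[>] 0, 0 < a v) :
    ∃ C : ℝ, 0 < C ∧ ∀ᶠ v in 𝓝[>] (0 : ℝ), ∀ x ∈ Ioc 0 v, |ℓ x - ℓ v| ≤ C * a v := by
  obtain ⟨C, hC, -⟩ := EReal.lt_iff_exists_real_btwn.1 h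
  refine ⟨max C 1, by positivity, ?_⟩
  filter_upwards [eventually_lt_of_limsup_lt hC, ha, self_mem_nhdsWithin] with v hv hav hv0 x hx
  have hv0 : (0 : ℝ) < v := hv0
  have hu : x / v ∈ Ioc (0 : ℝ) 1 := ⟨div_pos hx.1 hv0, div_le_one_of_le₀ hx.2 hv0.le⟩
  have h1 := (le_iSup₂ (f := fun (u : ℝ) (_ : u ∈ Ioc (0 : ℝ) 1) =>
    ((|ℓ (u * v) - ℓ v| / a v : ℝ) : EReal)) (x / v) hu).trans hv.le
  rw [EReal.coe_le_coe_iff, div_mul_cancel₀ _ hv0.ne', div_le_iff₀ hav] at h1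
  exact h1.trans (by gcongr; exact le_max_left _ _)

theorem abs_log_le_of_abs_sub_one_le {y η : ℝ} (h : |y - 1| ≤ η) (hη : η ≤ 1 / 2) :
    |Real.log y| ≤ 2 * η := by
  obtain ⟨h1, h2⟩ := abs_le.1 h
  have hy : 0 < y := by linarith
  rw [abs_le]
  constructor
  · have h3 := Real.one_sub_inv_le_log_of_pos hy
    have h4 : y⁻¹ ≤ 1 + 2 * η := by
      rw [inv_le_comm₀ hy (by linarith), inv_le_iff_one_le_mul₀ (by linarith)]
      nlinarith
    linarith
  · have h3 := Real.log_le_sub_one_of_pos hy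
    linarith

/-- The second-order condition controls `log (ℓ x / ℓ y)` uniformly for `x, y ≤ 2 v`. -/
theorem exists_abs_log_ratio_le {ℓ a : ℝ → ℝ} {ρ : ℝ} (hℓ : SlowlyVaryingAtZero ℓ)
    (ha : RegularlyVaryingAtZero a ρ) (hℓa : UniformSecondOrder ℓ a)
    (haℓ : Tendsto (fun v => a v / ℓ v) (𝓝[>] 0) (𝓝 0)) :
    ∃ C : ℝ, 0 < C ∧ ∀ᶠ v in 𝓝[>] (0 : ℝ), 0 < a v / ℓ v ∧
      ∀ x ∈ Ioc 0 (2 * v), 0 < ℓ x ∧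
        ∀ y ∈ Ioc 0 (2 * v), |Real.log (ℓ x / ℓ y)| ≤ C * (a v / ℓ v) := by
  obtain ⟨δa, hδa, hposa, -⟩ := ha.pos_measurable
  obtain ⟨δl, hδl, hposl, -⟩ := hℓ.pos_measurable
  have hapos : ∀ᶠ v in 𝓝[>] (0 : ℝ), 0 < a v := by
    filter_upwards [Ioo_mem_nhdsGT hδa] with v hv using hposa v hv
  have hlpos : ∀ᶠ v in 𝓝[>] (0 : ℝ), 0 < ℓ v := by
    filter_upwards [Ioo_mem_nhdsGT hδl] with v hv using hposl v hv
  obtain ⟨C, hC, hCv⟩ := exists_abs_sub_le_of_uniformSecondOrder hℓa hapos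
  have hdouble : Tendsto (fun v : ℝ => 2 * v) (𝓝[>] 0) (𝓝[>] 0) := by
    refine tendsto_nhdsWithin_iff.2 ⟨?_, ?_⟩
    · have : Tendsto (fun v : ℝ => 2 * v) (𝓝 0) (𝓝 (2 * 0)) := by
        exact (continuous_const.mul continuous_id).tendsto 0
      rw [mul_zero] at this
      exact this.mono_left nhdsWithin_le_nhds
    · filter_upwards [self_mem_nhdsWithin] with v hv
      have : (0 : ℝ) < v := hv
      exact mem_Ioi.2 (by linarith)
  -- All comparisons are made with the base point `2 v`. Regular variation carries the bound back to
  -- `v`: the ratio of `a / ℓ` at `2 v` and at `v` tends to `2 ^ ρ`, hence is eventually below `D`.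
  have hratio : Tendsto (fun v => (a (2 * v) / a v) / (ℓ (2 * v) / ℓ v)) (𝓝[>] 0)
      (𝓝 (2 ^ ρ / 2 ^ (0 : ℝ))) :=
    (ha.tendsto_ratio 2 two_pos).div (hℓ.tendsto_ratio 2 two_pos) (by simp)
  rw [Real.rpow_zero, div_one] at hratio
  set D : ℝ := 2 ^ ρ + 1 with hD
  have hD0 : 0 < D := by positivity
  have hη : ∀ᶠ v in 𝓝[>] (0 : ℝ), C * (a (2 * v) / ℓ (2 * v)) ≤ 1 / 2 := by
    have := (haℓ.comp hdouble).const_mul C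
    rw [mul_zero] at this
    exact this.eventually_le_const (by norm_num)
  -- Two logarithms relative to `ℓ (2 v)`, each at most `2 C a(2v)/ℓ(2v)`, and the factor `D` from
  -- the change of base point.
  refine ⟨4 * C * D, by positivity, ?_⟩
  filter_upwards [hapos, hlpos, hdouble.eventually hapos, hdouble.eventually hlpos,
    hdouble.eventually hCv, hη, hratio.eventually_le_const (lt_add_one _),
    hdouble.eventually (Ioo_mem_nhdsGT hδl)] with v h1 h2 h3 h4 h5 h6 h7 h8
  have hsmall : a (2 * v) / ℓ (2 * v) ≤ D * (a v / ℓ v) := by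
    have e : a (2 * v) / ℓ (2 * v) =
        (a (2 * v) / a v) / (ℓ (2 * v) / ℓ v) * (a v / ℓ v) := by
      field_simp
    rw [e]
    gcongr
  have hlog : ∀ x ∈ Ioc 0 (2 * v), 0 < ℓ x ∧
      |Real.log (ℓ x / ℓ (2 * v))| ≤ 2 * (C * (a (2 * v) / ℓ (2 * v))) := by
    intro x hx
    refine ⟨hposl x ⟨hx.1, hx.2.trans_lt h8.2⟩, abs_log_le_of_abs_sub_one_le ?_ h6⟩
    have e : ℓ x / ℓ (2 * v) - 1 = (ℓ x - ℓ (2 * v)) / ℓ (2 * v) := by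
      field_simp
    rw [e, abs_div, abs_of_pos h4, ← mul_div_assoc]
    gcongr
    exact h5 x hx
  refine ⟨div_pos h1 h2, fun x hx => ⟨(hlog x hx).1, fun y hy => ?_⟩⟩
  obtain ⟨hx0, hx1⟩ := hlog x hx
  obtain ⟨hy0, hy1⟩ := hlog y hy
  have e : Real.log (ℓ x / ℓ y) = Real.log (ℓ x / ℓ (2 * v)) - Real.log (ℓ y / ℓ (2 * v)) := by
    rw [Real.log_div hx0.ne' hy0.ne', Real.log_div hx0.ne' h4.ne', Real.log_div hy0.ne' h4.ne']
    ring
  rw [e]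
  calc _ ≤ _ := abs_sub _ _
    _ ≤ 4 * C * (a (2 * v) / ℓ (2 * v)) := by linarith
    _ ≤ 4 * C * (D * (a v / ℓ v)) := by gcongr
    _ = _ := by ring

/-- Bernoulli's inequality at `(a - b) / b`, multiplied by `b ^ p`. -/
theorem rpow_sub_rpow_le {a b p : ℝ} (ha : 0 ≤ a) (hab : a ≤ b) (hp : 1 ≤ p) :
    b ^ p - a ^ p ≤ p * (b - a) * b ^ (p - 1) := by
  rcases (ha.trans hab).eq_or_lt with hb | hb
  · have : a = 0 := le_antisymm (hab.trans hb.symm.le) ha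
    rw [← hb, this]
    simp
  · have h := one_add_mul_self_le_rpow_one_add (s := (a - b) / b)
      (by rw [le_div_iff₀ hb]; linarith) hp
    have e : 1 + (a - b) / b = a / b := by field_simp; ring
    rw [e, Real.div_rpow ha hb.le, le_div_iff₀ (by positivity)] at h
    have e2 : b ^ p = b ^ (p - 1) * b := by
      rw [← Real.rpow_add_one hb.ne']
      congr 1
      ring
    have e3 : (1 + p * ((a - b) / b)) * b ^ p = b ^ p - p * (b - a) * b ^ (p - 1) := by
      rw [e2]
      field_simp
      ring
    linarith

/-- Whichever of `x`, `y` is larger lies below `y + ε`. The bound involves `y` alone, so in the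
application it is a function of the ratio of order statistics, whose sums have a known law. -/
theorem abs_rpow_sub_rpow_le {x y p ε : ℝ} (hx : 0 ≤ x) (hy : 0 ≤ y) (hp : 1 ≤ p)
    (h : |x - y| ≤ ε) : |x ^ p - y ^ p| ≤ p * ε * (y + ε) ^ (p - 1) := by
  obtain ⟨h1, h2⟩ := abs_le.1 h
  have hε : 0 ≤ ε := (abs_nonneg _).trans h
  rcases le_total x y with hxy | hxy
  · rw [abs_sub_comm, abs_of_nonneg (sub_nonneg.2 (Real.rpow_le_rpow hx hxy (by linarith)))]
    refine (rpow_sub_rpow_le hx hxy hp).trans ?_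
    have : y ^ (p - 1) ≤ (y + ε) ^ (p - 1) := Real.rpow_le_rpow hy (by linarith) (by linarith)
    gcongr
    linarith
  · rw [abs_of_nonneg (sub_nonneg.2 (Real.rpow_le_rpow hy hxy (by linarith)))]
    refine (rpow_sub_rpow_le hy hxy hp).trans ?_
    have : x ^ (p - 1) ≤ (y + ε) ^ (p - 1) := Real.rpow_le_rpow hx (by linarith) (by linarith)
    gcongr

/-- Replacing the quantile function by a pure power changes the `p`-th power of a log-excess
only slightly. -/
theorem abs_log_quantile_ratio_rpow_sub_le {ν : Measure ℝ} [IsProbabilityMeasure ν] {γ : ℝ}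
    (hγ : 0 < γ) {ℓ : ℝ → ℝ} (hQ : ∀ s ∈ Ioo (0 : ℝ) 1, quantile ν (1 - s) = s ^ (-γ) * ℓ s)
    {x y ε p : ℝ} (hx : 0 < x) (hxy : x ≤ y) (hy : y < 1) (hℓx : 0 < ℓ x) (hℓy : 0 < ℓ y)
    (hε : |Real.log (ℓ x / ℓ y)| ≤ ε) (hp : 1 ≤ p) :
    |Real.log (quantile ν (1 - x) / quantile ν (1 - y)) ^ p - (γ * |Real.log (x / y)|) ^ p| ≤
      p * ε * (γ * |Real.log (x / y)| + ε) ^ (p - 1) := by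
  have hy0 : 0 < y := hx.trans_le hxy
  have hqx := hQ x ⟨hx, hxy.trans_lt hy⟩
  have hqy := hQ y ⟨hy0, hy⟩
  have hqy0 : 0 < quantile ν (1 - y) := by
    rw [hqy]
    exact mul_pos (Real.rpow_pos_of_pos hy0 _) hℓy
  -- Monotonicity of the quantile function makes the log-excess nonnegative, as the power estimate
  -- requires; the two bases then differ exactly by `log (ℓ x / ℓ y)`.
  have hmono : quantile ν (1 - y) ≤ quantile ν (1 - x) :=
    quantile_mono (by linarith) (by linarith) (by linarith)
  refine abs_rpow_sub_rpow_le (Real.log_nonneg ((one_le_div hqy0).2 hmono)) (by positivity) hp ?_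
  have hlog : |Real.log (x / y)| = -(Real.log x - Real.log y) := by
    rw [← Real.log_div hx.ne' hy0.ne']
    exact abs_of_nonpos (Real.log_nonpos (by positivity) (div_le_one_of_le₀ hxy hy0.le))
  rw [hlog]
  convert! hε using 2
  rw [hqx, hqy, Real.log_div (by positivity) (by positivity), Real.log_mul (by positivity)
    hℓx.ne', Real.log_mul (by positivity) hℓy.ne', Real.log_rpow hx, Real.log_rpow hy0,
    Real.log_div hℓx.ne' hℓy.ne']
  ring

/-! ### Replacing the log-excesses by those of an exact Pareto sample -/

/-- Using `|log u|` for `-log u` keeps the base of the power nonnegative at every real `u`, so that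
pointwise bounds need no exceptional set. -/
theorem abs_log_ae_unif : ∀ᵐ u ∂unif, |Real.log u| = -Real.log u := by
  refine (ae_restrict_mem measurableSet_Ioo).mono fun u hu => ?_
  exact abs_of_nonpos (Real.log_nonpos hu.1.le hu.2.le)

theorem integrable_unif_abs_log_rpow {γ q : ℝ} (hγ : 0 < γ) (hq : -1 < q) :
    Integrable (fun u => (γ * |Real.log u|) ^ q) unif :=
  (integrable_unif_rpow hγ hq).congr (abs_log_ae_unif.mono fun u hu => by simp only [hu])

theorem integral_unif_abs_log_rpow {γ q : ℝ} (hγ : 0 < γ) (hq : -1 < q) :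
    ∫ u, (γ * |Real.log u|) ^ q ∂unif = mLim γ q := by
  rw [← integral_unif_rpow hγ hq]
  exact integral_congr_ae (abs_log_ae_unif.mono fun u hu => by simp only [hu])

/-- The factor `p` is absorbed by `p Γ(p) = Γ(p + 1)`, so the mean error relative to `m_p` is
bounded independently of `p`. -/
theorem lintegral_unif_error_le {γ p ε : ℝ} (hγ : 0 < γ) (hp : 1 ≤ p) (hε : 0 ≤ ε) :
    ∫⁻ u, ENNReal.ofReal (p * ε * (γ * |Real.log u| + ε) ^ (p - 1)) ∂unif ≤
      ENNReal.ofReal (ε / γ * Real.exp (ε / γ) * mLim γ p) := by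
  have e : ∫⁻ u, ENNReal.ofReal (p * ε * (γ * |Real.log u| + ε) ^ (p - 1)) ∂unif =
      ENNReal.ofReal (p * ε) *
        ∫⁻ u, ENNReal.ofReal ((γ * -Real.log u + ε) ^ (p - 1)) ∂unif := by
    rw [← lintegral_const_mul' _ _ ENNReal.ofReal_ne_top]
    refine lintegral_congr_ae (abs_log_ae_unif.mono fun u hu => ?_)
    simp only [hu]
    rw [ENNReal.ofReal_mul (by positivity)]
  rw [e]
  calc _ ≤ ENNReal.ofReal (p * ε) * ENNReal.ofReal (Real.exp (ε / γ) * mLim γ (p - 1)) := by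
        gcongr
        exact lintegral_unif_shift_rpow_le hγ (by linarith) hε
    _ = _ := by
        rw [← ENNReal.ofReal_mul (by positivity)]
        congr 1
        have h1 : Real.Gamma (p + 1) = p * Real.Gamma p := Real.Gamma_add_one (by linarith)
        have h2 : γ ^ p = γ ^ (p - 1) * γ := by
          rw [← Real.rpow_add_one hγ.ne']
          congr 1
          ring
        rw [mLim, mLim, h1, h2, sub_add_cancel]
        field_simp

theorem exists_orderStat_eq (x : ℕ → ℝ) {n i : ℕ} (hi : 1 ≤ i) (hin : i ≤ n) :
    ∃ j, orderStat x n i = x j := by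
  rw [orderStat, dif_pos ⟨hi, hin⟩]
  exact ⟨_, rfl⟩

theorem orderStat_mono (x : ℕ → ℝ) {n i j : ℕ} (hi : 1 ≤ i) (hij : i ≤ j) (hj : j ≤ n) :
    orderStat x n i ≤ orderStat x n j := by
  rw [orderStat, dif_pos ⟨hi, hij.trans hj⟩, orderStat, dif_pos ⟨hi.trans hij, hj⟩]
  refine Tuple.monotone_sort (fun j : Fin n => x j) ?_
  rw [Fin.le_def]
  simp only
  omega

namespace IsUniformSample

variable {Ω : Type*} [MeasurableSpace Ω] {P : Measure Ω} {U : ℕ → Ω → ℝ}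

theorem ae_mem_Ioo (hU : IsUniformSample U P) : ∀ᵐ ω ∂P, ∀ j, U j ω ∈ Ioo (0 : ℝ) 1 := by
  rw [ae_all_iff]
  intro j
  exact (hU.measurePreserving j).quasiMeasurePreserving.ae (ae_restrict_mem measurableSet_Ioo)

theorem measurable_logExcessPow (hU : IsUniformSample U P) (ν : Measure ℝ)
    [IsProbabilityMeasure ν] (n k i : ℕ) (p : ℝ) :
    Measurable fun ω => logExcessPow ν (fun j => U j ω) n k p i := by
  have h : ∀ i, Measurable fun ω => quantile ν (1 - orderStat (fun j => U j ω) n i) := fun i =>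
    (measurable_quantile ν).comp (measurable_const.sub (hU.measurable_orderStat_comp n i))
  exact ((h i).div (h (k + 1))).log.pow_const p

variable [IsProbabilityMeasure P]

theorem measure_sum_orderStat_ratio (hU : IsUniformSample U P) {n k : ℕ} (hk : k < n) {φ : ℝ → ℝ}
    (hφ : Measurable φ) {B : Set ℝ} (hB : MeasurableSet B) :
    P {ω | ∑ i ∈ Finset.Icc 1 k, φ (orderStat (fun j => U j ω) n i /
        orderStat (fun j => U j ω) n (k + 1)) ∈ B} =
      P {ω | ∑ i ∈ Finset.range k, φ (U i ω) ∈ B} := by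
  have hm1 : Measurable fun ω => ∑ i ∈ Finset.Icc 1 k, φ (orderStat (fun j => U j ω) n i /
      orderStat (fun j => U j ω) n (k + 1)) :=
    Finset.measurable_fun_sum _ fun i _ => hφ.comp
      ((hU.measurable_orderStat_comp n i).div (hU.measurable_orderStat_comp n (k + 1)))
  have hm2 : Measurable fun ω => ∑ i ∈ Finset.range k, φ (U i ω) :=
    Finset.measurable_fun_sum _ fun i _ => hφ.comp (hU.measurable i)
  have h := congrArg (fun m : Measure ℝ => m B) (hU.map_sum_orderStat_ratio hk hφ)
  rwa [Measure.map_apply hm1 hB, Measure.map_apply hm2 hB] at h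

/-- The order statistic of rank `k + 1` is at most `2 k / n` with high probability. -/
theorem measure_lt_orderStat_le (hU : IsUniformSample U P) {n k : ℕ} (hk : 0 < k)
    (hkn : 2 * k < n) :
    P {ω | 2 * ((k : ℝ) / n) < orderStat (fun j => U j ω) n (k + 1)} ≤
      ENNReal.ofReal (2 / k) := by
  have hk0 : (0 : ℝ) < k := Nat.cast_pos.2 hk
  have hn0 : (0 : ℝ) < n := Nat.cast_pos.2 (by omega)
  have hkn' : 2 * (k : ℝ) < n := by exact_mod_cast hkn
  set t : ℝ := 2 * ((k : ℝ) / n) with ht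
  have hnt : n * t = 2 * k := by rw [ht]; field_simp
  have ht1 : t < 1 := by rw [ht, ← mul_div_assoc, div_lt_one hn0]; exact hkn'
  have ht0 : 0 < t := by positivity
  -- The number of sample points `≤ t` has mean `2 k` and variance at most `2 k`. The event forces
  -- it to be at most `k`, a deviation of at least `k`, and Chebyshev gives `2 k / k ^ 2`.
  let f : ℝ → ℝ := (Iic t).indicator 1
  have hf : Measurable f := measurable_one.indicator measurableSet_Iic
  have hint : ∫ u, f u ∂unif = t := by
    rw [integral_indicator_one measurableSet_Iic, measureReal_def,
      Measure.restrict_apply measurableSet_Iic]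
    have : Iic t ∩ Ioo (0 : ℝ) 1 = Ioc 0 t := by
      ext u
      simp only [mem_inter_iff, mem_Iic, mem_Ioo, mem_Ioc]
      constructor
      · rintro ⟨h1, h2, h3⟩; exact ⟨h2, h1⟩
      · rintro ⟨h1, h2⟩; exact ⟨h2, h1, by linarith⟩
    rw [this]
    simp [ht0.le]
  have hsq : ∀ u, f u ^ 2 = f u := fun u => by
    by_cases hu : u ∈ Iic t <;> simp [f, hu]
  have hf2 : MemLp f 2 unif := MemLp.of_bound hf.aestronglyMeasurable 1
    (Eventually.of_forall fun u => by by_cases hu : u ∈ Iic t <;> simp [f, hu])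
  have h := hU.measure_abs_sum_sub_ge_le hf hf2 n hk0
  simp only [hsq] at h
  rw [hint, hnt] at h
  refine (measure_mono fun ω hω => ?_).trans (h.trans (le_of_eq ?_))
  · simp only [mem_ofPred_eq] at hω ⊢
    let K : Fin n := ⟨k, by omega⟩
    have h1 := orderStat_eq_sortedVec (fun j => U j ω) K
    rw [show (K : ℕ) = k from rfl] at h1
    rw [h1] at hω
    have h2 := card_le_of_lt_sortedVec _ K hω
    have h3 : ∑ i ∈ Finset.range n, f (U i ω) =
        ((Finset.univ.filter fun j : Fin n => U j ω ≤ t).card : ℝ) := by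
      rw [Finset.sum_range, Finset.card_filter, Nat.cast_sum]
      refine Finset.sum_congr rfl fun i _ => ?_
      simp [f, indicator]
    have h4 : ((Finset.univ.filter fun j : Fin n => U j ω ≤ t).card : ℝ) ≤ k := by
      exact_mod_cast h2
    rw [h3, abs_sub_comm]
    exact le_trans (by linarith) (le_abs_self _)
  · congr 1
    field_simp

/-- Up to a negligible error, the log-excesses may be replaced by those of an exact power law. -/
theorem tendstoInMeasure_sum_logExcessPow_sub (hU : IsUniformSample U P) {ν : Measure ℝ}
    [IsProbabilityMeasure ν] {γ : ℝ} (hγ : 0 < γ) {ℓ : ℝ → ℝ}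
    (hQ : ∀ s ∈ Ioo (0 : ℝ) 1, quantile ν (1 - s) = s ^ (-γ) * ℓ s)
    {k : ℕ → ℕ} (hk : Tendsto k atTop atTop)
    (hkn : Tendsto (fun n => (k n : ℝ) / n) atTop (𝓝 0))
    {p : ℕ → ℝ} (hp : Tendsto p atTop atTop) {ε s : ℕ → ℝ}
    (hε : ∀ᶠ n in atTop, 0 ≤ ε n ∧ ∀ x ∈ Ioc (0 : ℝ) (2 * ((k n : ℝ) / n)), 0 < ℓ x ∧
      ∀ y ∈ Ioc (0 : ℝ) (2 * ((k n : ℝ) / n)), |Real.log (ℓ x / ℓ y)| ≤ ε n)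
    (hs : ∀ᶠ n in atTop, 0 < s n)
    (hlim : Tendsto (fun n => (k n : ℝ) * (ε n / γ * Real.exp (ε n / γ) * mLim γ (p n)) / s n)
      atTop (𝓝 0)) :
    TendstoInMeasure P (fun n ω => 1 / s n *
      (∑ i ∈ Finset.Icc 1 (k n), logExcessPow ν (fun j => U j ω) n (k n) (p n) i -
        ∑ i ∈ Finset.Icc 1 (k n), (γ * |Real.log (orderStat (fun j => U j ω) n i /
          orderStat (fun j => U j ω) n (k n + 1))|) ^ (p n))) atTop (fun _ => 0) := by
  rw [tendstoInMeasure_iff_norm]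
  intro δ hδ
  have hk' : Tendsto (fun n => (k n : ℝ)) atTop atTop := tendsto_natCast_atTop_atTop.comp hk
  have hbound : Tendsto (fun n => ENNReal.ofReal (2 / k n) + ENNReal.ofReal
      ((k n : ℝ) * (ε n / γ * Real.exp (ε n / γ) * mLim γ (p n)) / s n / δ)) atTop (𝓝 0) := by
    have h1 := ENNReal.tendsto_ofReal (hk'.const_div_atTop 2)
    have h2 := ENNReal.tendsto_ofReal (hlim.div_const δ)
    simpa using h1.add h2
  refine tendsto_of_tendsto_of_tendsto_of_le_of_le' tendsto_const_nhds hbound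
    (Eventually.of_forall fun _ => zero_le) ?_
  filter_upwards [hε, hs, hk.eventually_ge_atTop 1, hp.eventually_ge_atTop 1,
    hkn.eventually_lt_const (show (0 : ℝ) < 1 / 2 by norm_num), eventually_gt_atTop 0]
    with n ⟨hε0, hε1⟩ hs0 hk1 hp1 hkn1 hn
  have hn0 : (0 : ℝ) < n := Nat.cast_pos.2 hn
  have h2k : 2 * k n < n := by
    rw [div_lt_iff₀ hn0] at hkn1
    have : 2 * (k n : ℝ) < n := by linarith
    exact_mod_cast this
  set K := k n
  set t : ℝ := 2 * ((K : ℝ) / n) with ht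
  have ht1 : t < 1 := by linarith
  -- The error bound for one summand as a function of the ratio of order statistics; the identity in
  -- law replaces its sum by one over independent uniforms, to which Markov's inequality applies.
  let g : ℝ → ℝ := fun u => p n * ε n * (γ * |Real.log u| + ε n) ^ (p n - 1)
  have hg : Measurable g := by fun_prop
  have hg0 : ∀ u, 0 ≤ g u := fun u => by positivity
  let T : Ω → ℝ := fun ω => ∑ i ∈ Finset.Icc 1 K, g (orderStat (fun j => U j ω) n i /
    orderStat (fun j => U j ω) n (K + 1))
  have hT : P {ω | δ * s n ≤ T ω} ≤ ENNReal.ofReal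
      (K * (ε n / γ * Real.exp (ε n / γ) * mLim γ (p n)) / s n / δ) := by
    have hδs : 0 < δ * s n := by positivity
    have h1 : P {ω | δ * s n ≤ T ω} =
        P {ω | δ * s n ≤ ∑ i ∈ Finset.range K, g (U i ω)} :=
      hU.measure_sum_orderStat_ratio (n := n) (k := K) (by omega) hg measurableSet_Ici
    have h3 := meas_ge_le_lintegral_div (μ := P)
      (f := fun ω => ∑ i ∈ Finset.range K, ENNReal.ofReal (g (U i ω)))
      (Finset.measurable_fun_sum _ fun i _ =>
        (hg.comp (hU.measurable i)).ennreal_ofReal).aemeasurable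
      (ε := ENNReal.ofReal (δ * s n)) (by simpa using hδs) ENNReal.ofReal_ne_top
    rw [h1]
    refine (measure_mono fun ω hω => ?_).trans (h3.trans ?_)
    · simp only [mem_ofPred_eq] at hω ⊢
      rw [← ENNReal.ofReal_sum_of_nonneg fun i _ => hg0 _]
      exact ENNReal.ofReal_le_ofReal hω
    · rw [hU.lintegral_sum (g := fun u => ENNReal.ofReal (g u)) hg.ennreal_ofReal]
      calc _ ≤ (K : ENNReal) * ENNReal.ofReal (ε n / γ * Real.exp (ε n / γ) * mLim γ (p n)) /
            ENNReal.ofReal (δ * s n) := by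
            gcongr
            exact lintegral_unif_error_le hγ hp1 hε0
        _ = _ := by
            rw [← ENNReal.ofReal_natCast, ← ENNReal.ofReal_mul (Nat.cast_nonneg _),
              ← ENNReal.ofReal_div_of_pos hδs]
            congr 1
            field_simp
  refine le_trans ?_ (add_le_add (hU.measure_lt_orderStat_le (by omega) h2k) hT)
  -- If `U_{k+1,n} ≤ t`, all order statistics involved lie in `(0, t]`, where the hypothesis on `ℓ`
  -- applies.
  refine le_trans (measure_mono_ae ?_) (measure_union_le _ _)
  filter_upwards [hU.ae_mem_Ioo] with ω hω hωδ
  have hωδ : δ ≤ ‖1 / s n *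
      (∑ i ∈ Finset.Icc 1 K, logExcessPow ν (fun j => U j ω) n K (p n) i -
        ∑ i ∈ Finset.Icc 1 K, (γ * |Real.log (orderStat (fun j => U j ω) n i /
          orderStat (fun j => U j ω) n (K + 1))|) ^ (p n)) - 0‖ := hωδ
  change ω ∈ {ω | t < orderStat (fun j => U j ω) n (K + 1)} ∪ {ω | δ * s n ≤ T ω}
  rw [mem_union]
  by_contra hcon
  push Not at hcon
  obtain ⟨hV, hTω⟩ := hcon
  simp only [mem_ofPred_eq, not_lt, not_le] at hV hTω
  have hmem : ∀ i, 1 ≤ i → i ≤ n → orderStat (fun j => U j ω) n i ∈ Ioo (0 : ℝ) 1 := by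
    intro i h1 h2
    obtain ⟨j, hj⟩ := exists_orderStat_eq (fun j => U j ω) h1 h2
    rw [hj]
    exact hω j
  have hV0 := hmem (K + 1) (by omega) (by omega)
  have hdiff : |∑ i ∈ Finset.Icc 1 K, logExcessPow ν (fun j => U j ω) n K (p n) i -
      ∑ i ∈ Finset.Icc 1 K, (γ * |Real.log (orderStat (fun j => U j ω) n i /
        orderStat (fun j => U j ω) n (K + 1))|) ^ (p n)| ≤ T ω := by
    rw [← Finset.sum_sub_distrib]
    refine (Finset.abs_sum_le_sum_abs _ _).trans (Finset.sum_le_sum fun i hi => ?_)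
    rw [Finset.mem_Icc] at hi
    have hx := hmem i hi.1 (by omega)
    have hxy := orderStat_mono (fun j => U j ω) hi.1 (show i ≤ K + 1 by omega)
      (show K + 1 ≤ n by omega)
    have h1 := hε1 _ ⟨hx.1, hxy.trans hV⟩
    have h2 := hε1 _ ⟨hV0.1, hV⟩
    exact abs_log_quantile_ratio_rpow_sub_le hγ hQ hx.1 hxy hV0.2 h1.1 h2.1
      (h1.2 _ ⟨hV0.1, hV⟩) hp1
  rw [sub_zero, Real.norm_eq_abs, abs_mul, abs_of_pos (by positivity), one_div, inv_mul_eq_div,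
    le_div_iff₀ hs0] at hωδ
  linarith

end IsUniformSample

/-! ### Growth conditions -/

theorem mLim_ratio {γ p r : ℝ} (hγ : 0 < γ) (hp : 0 < p) :
    mLim γ ((1 + r) * p) / mLim γ p ^ (1 + r) =
      Real.Gamma ((1 + r) * p + 1) / Real.Gamma (p + 1) ^ (1 + r) := by
  have hG : 0 < Real.Gamma (p + 1) := Real.Gamma_pos_of_pos (by linarith)
  have h : γ ^ ((1 + r) * p) = (γ ^ p) ^ (1 + r) := by
    rw [← Real.rpow_mul hγ.le]
    congr 1
    ring
  have h0 : 0 < (γ ^ p) ^ (1 + r) := by positivity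
  rw [mLim, mLim, Real.mul_rpow (by positivity) hG.le, h]
  field_simp

/-- Since `log (1 + r) ≤ r`, the moment ratio is at most `(1 + r) exp (r (1 + r) q)`, whereas `k ^ r
≥ exp (r (1 + η) q)`. Taken with `q = p` for the weak law and `q = 2 p` for the central limit
theorem. -/
theorem tendsto_mLim_ratio_div {γ : ℝ} (hγ : 0 < γ) {q : ℕ → ℝ} (hq : Tendsto q atTop atTop)
    {k : ℕ → ℕ} (hk : Tendsto k atTop atTop) {η r : ℝ} (hr : 0 < r) (hrη : r < η)
    (h : ∀ᶠ n in atTop, (1 + η) * q n ≤ Real.log (k n)) :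
    Tendsto (fun n => mLim γ ((1 + r) * q n) / mLim γ (q n) ^ (1 + r) / (k n : ℝ) ^ r) atTop
      (𝓝 0) := by
  have hlim : Tendsto (fun n => (1 + r) * Real.exp (-(r * (η - r) * q n))) atTop (𝓝 0) := by
    have h1 : Tendsto (fun n => r * (η - r) * q n) atTop atTop :=
      hq.const_mul_atTop (mul_pos hr (sub_pos.2 hrη))
    simpa using (Real.tendsto_exp_neg_atTop_nhds_zero.comp h1).const_mul (1 + r)
  refine tendsto_of_tendsto_of_tendsto_of_le_of_le' tendsto_const_nhds hlim ?_ ?_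
  · filter_upwards [hq.eventually_gt_atTop 0] with n hn
    have := mLim_pos (γ := γ) (q := q n) hγ (by linarith)
    have := mLim_pos (γ := γ) (q := (1 + r) * q n) hγ (by nlinarith)
    positivity
  · filter_upwards [h, hq.eventually_gt_atTop 0, hk.eventually_ge_atTop 1] with n h1 hn hk1
    have hk0 : (0 : ℝ) < k n := Nat.cast_pos.2 hk1
    have hG : 0 < Real.Gamma (q n + 1) := Real.Gamma_pos_of_pos (by linarith)
    rw [mLim_ratio hγ hn]
    have h2 : Real.Gamma ((1 + r) * q n + 1) / Real.Gamma (q n + 1) ^ (1 + r) ≤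
        (1 + r) ^ ((1 + r) * q n + 1) := by
      rw [div_le_iff₀ (by positivity)]
      exact Gamma_mul_add_one_le hn hr
    calc _ ≤ (1 + r) ^ ((1 + r) * q n + 1) / (k n : ℝ) ^ r := by gcongr
      _ = (1 + r) * Real.exp (Real.log (1 + r) * ((1 + r) * q n) - Real.log (k n) * r) := by
        rw [Real.rpow_add_one (by positivity), Real.exp_sub, Real.rpow_def_of_pos (by positivity),
          Real.rpow_def_of_pos hk0]
        ring
      _ ≤ _ := by
        gcongr
        have h3 : Real.log (1 + r) ≤ r := by
          have := Real.log_le_sub_one_of_pos (show 0 < 1 + r by positivity)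
          linarith
        have h4 : Real.log (1 + r) * ((1 + r) * q n) ≤ r * ((1 + r) * q n) := by gcongr
        have h5 : (1 + η) * q n * r ≤ Real.log (k n) * r := by gcongr
        nlinarith

theorem exists_eventually_mul_le_of_lt_liminf {x p : ℕ → ℝ} (hp : Tendsto p atTop atTop) {c : ℝ}
    (h : (c : EReal) < liminf (fun n => ((x n / p n : ℝ) : EReal)) atTop) :
    ∃ b, c < b ∧ ∀ᶠ n in atTop, b * p n ≤ x n := by
  obtain ⟨b, hb, hb'⟩ := EReal.lt_iff_exists_real_btwn.1 h
  refine ⟨b, EReal.coe_lt_coe_iff.1 hb, ?_⟩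
  filter_upwards [eventually_lt_of_lt_liminf hb', hp.eventually_gt_atTop 0] with n hn hpn
  rw [EReal.coe_lt_coe_iff, lt_div_iff₀ hpn] at hn
  exact hn.le

/-- The squared mean is exponentially small compared to the second moment. -/
theorem mLim_sq_le {γ p : ℝ} (hγ : 0 < γ) (hp : 2 ≤ p) :
    mLim γ p ^ 2 ≤ √Real.pi * p * Real.exp (-(2 * Real.log 2 * p)) * mLim γ (2 * p) := by
  have h := four_rpow_mul_Gamma_sq_le hp
  have h4 : (4 : ℝ) ^ p = Real.exp (2 * Real.log 2 * p) := by
    rw [Real.rpow_def_of_pos (by norm_num), show (4 : ℝ) = 2 ^ 2 by norm_num, Real.log_pow]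
    norm_num
  have hγ2 : γ ^ (2 * p) = (γ ^ p) ^ 2 := by
    rw [mul_comm, Real.rpow_mul hγ.le]
    norm_cast
  have h5 : Real.Gamma (p + 1) ^ 2 ≤
      Real.exp (-(2 * Real.log 2 * p)) * (√Real.pi * p * Real.Gamma (2 * p + 1)) := by
    rw [Real.exp_neg, le_inv_mul_iff₀ (Real.exp_pos _), ← h4]
    exact h
  rw [mLim, mLim, mul_pow, hγ2]
  calc (γ ^ p) ^ 2 * Real.Gamma (p + 1) ^ 2 ≤ (γ ^ p) ^ 2 *
        (Real.exp (-(2 * Real.log 2 * p)) * (√Real.pi * p * Real.Gamma (2 * p + 1))) := by gcongr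
    _ = _ := by ring

theorem sigmaLim_eq (γ : ℝ) (hγ : 0 < γ) (p : ℝ) :
    sigmaLim γ p = √(mLim γ (2 * p) - mLim γ p ^ 2) := by
  have hγ2 : γ ^ (2 * p) = (γ ^ p) ^ 2 := by
    rw [mul_comm, Real.rpow_mul hγ.le]
    norm_cast
  rw [sigmaLim, mLim, mLim, hγ2]
  congr 1
  ring

/-- For large `p` the variance is at least half of the second moment. -/
theorem eventually_half_le_sigmaLim_sq {γ : ℝ} (hγ : 0 < γ) {p : ℕ → ℝ}
    (hp : Tendsto p atTop atTop) :
    ∀ᶠ n in atTop, 0 < sigmaLim γ (p n) ∧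
      sigmaLim γ (p n) ^ 2 = mLim γ (2 * p n) - mLim γ (p n) ^ 2 ∧
      mLim γ (2 * p n) / 2 ≤ sigmaLim γ (p n) ^ 2 := by
  have hlim : Tendsto (fun n => √Real.pi * (p n ^ (1 : ℝ) * Real.exp (-(2 * Real.log 2) * p n)))
      atTop (𝓝 0) := by
    have := ((tendsto_rpow_mul_exp_neg_mul_atTop_nhds_zero 1 (2 * Real.log 2)
      (by have := Real.log_pos one_lt_two; positivity)).comp hp).const_mul (√Real.pi)
    simpa using this
  filter_upwards [hlim.eventually_le_const (show (0 : ℝ) < 1 / 2 by norm_num),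
    hp.eventually_ge_atTop 2] with n h1 h2
  have h3 := mLim_sq_le hγ h2
  have hM := mLim_pos (γ := γ) (q := 2 * p n) hγ (by linarith)
  have h4 : mLim γ (p n) ^ 2 ≤ 1 / 2 * mLim γ (2 * p n) := by
    refine h3.trans ?_
    gcongr
    rw [Real.rpow_one, neg_mul, ← mul_assoc] at h1
    exact h1
  have h5 : sigmaLim γ (p n) ^ 2 = mLim γ (2 * p n) - mLim γ (p n) ^ 2 := by
    rw [sigmaLim_eq γ hγ, Real.sq_sqrt (by linarith)]
  refine ⟨?_, h5, by linarith⟩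
  rw [sigmaLim_eq γ hγ]
  exact Real.sqrt_pos.2 (by linarith)

/-- The standardized power has bounded moments relative to those of the exponential law. -/
theorem integral_abs_standardized_rpow_le {γ p r : ℝ} (hγ : 0 < γ) (hp : 0 < p) (hr : 0 < r)
    (hσ : 0 < sigmaLim γ p) (h1 : sigmaLim γ p ^ 2 = mLim γ (2 * p) - mLim γ p ^ 2)
    (h2 : mLim γ (2 * p) / 2 ≤ sigmaLim γ p ^ 2) :
    Integrable (fun u => |((γ * |Real.log u|) ^ p - mLim γ p) / sigmaLim γ p| ^ (2 + 2 * r))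
        unif ∧
      ∫ u, |((γ * |Real.log u|) ^ p - mLim γ p) / sigmaLim γ p| ^ (2 + 2 * r) ∂unif ≤
        2 ^ (1 + r) * (mLim γ ((1 + r) * (2 * p)) / mLim γ (2 * p) ^ (1 + r)) + 1 := by
  set m := mLim γ p
  set σ := sigmaLim γ p
  set M := mLim γ (2 * p) with hM
  have hm : 0 < m := mLim_pos hγ (by linarith)
  have hM0 : 0 < M := mLim_pos hγ (by linarith)
  have hq : -1 < (1 + r) * (2 * p) := by nlinarith [mul_pos hr hp]
  have hmσ : m ≤ σ := by
    refine le_of_sq_le_sq ?_ hσ.le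
    linarith
  have hσr : σ ^ (2 + 2 * r) = (σ ^ 2) ^ (1 + r) := by
    rw [← Real.rpow_natCast, ← Real.rpow_mul hσ.le]
    congr 1
    push_cast
    ring
  have hpt : ∀ u : ℝ, |((γ * |Real.log u|) ^ p - m) / σ| ^ (2 + 2 * r) ≤
      2 ^ (1 + r) * ((γ * |Real.log u|) ^ ((1 + r) * (2 * p)) / M ^ (1 + r)) + 1 := by
    intro u
    set X := (γ * |Real.log u|) ^ p with hX
    have hX0 : 0 ≤ X := by positivity
    have hXr : X ^ (2 + 2 * r) = (γ * |Real.log u|) ^ ((1 + r) * (2 * p)) := by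
      rw [hX, ← Real.rpow_mul (by positivity)]
      congr 1
      ring
    rw [abs_div, abs_of_pos hσ]
    -- Below the mean the standardized value is at most `m / σ ≤ 1`, whence the `+ 1`. Above it, `X
    -- / σ` dominates, and `M ≤ 2 σ ^ 2` produces `2 ^ (1 + r)`.
    rcases le_total X m with hXm | hXm
    · have h3 : |X - m| / σ ≤ 1 := by
        rw [div_le_one hσ, abs_sub_comm, abs_of_nonneg (sub_nonneg.2 hXm)]
        linarith
      have h4 := Real.rpow_le_one (by positivity) h3 (show 0 ≤ 2 + 2 * r by positivity)
      have h5 : 0 ≤ (2 : ℝ) ^ (1 + r) *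
          ((γ * |Real.log u|) ^ ((1 + r) * (2 * p)) / M ^ (1 + r)) := by positivity
      linarith
    · have h3 : |X - m| / σ ≤ X / σ := by
        gcongr
        rw [abs_of_nonneg (sub_nonneg.2 hXm)]
        linarith
      have h6 : M ^ (1 + r) ≤ 2 ^ (1 + r) * (σ ^ 2) ^ (1 + r) := by
        rw [← Real.mul_rpow (by norm_num) (by positivity)]
        exact Real.rpow_le_rpow hM0.le (by linarith) (by positivity)
      calc (|X - m| / σ) ^ (2 + 2 * r) ≤ (X / σ) ^ (2 + 2 * r) := by gcongr
        _ = X ^ (2 + 2 * r) / (σ ^ 2) ^ (1 + r) := by rw [Real.div_rpow hX0 hσ.le, hσr]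
        _ ≤ 2 ^ (1 + r) * (X ^ (2 + 2 * r) / M ^ (1 + r)) := by
          rw [div_le_iff₀ (by positivity)]
          have h7 : 0 ≤ X ^ (2 + 2 * r) / M ^ (1 + r) := by positivity
          calc X ^ (2 + 2 * r) = X ^ (2 + 2 * r) / M ^ (1 + r) * M ^ (1 + r) := by
                field_simp
            _ ≤ X ^ (2 + 2 * r) / M ^ (1 + r) * (2 ^ (1 + r) * (σ ^ 2) ^ (1 + r)) := by gcongr
            _ = _ := by ring
        _ ≤ _ := by rw [hXr]; linarith
  have hdom : Integrable (fun u => 2 ^ (1 + r) * ((γ * |Real.log u|) ^ ((1 + r) * (2 * p)) /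
      M ^ (1 + r)) + 1) unif :=
    (((integrable_unif_abs_log_rpow hγ hq).div_const _).const_mul _).add (integrable_const 1)
  have hint : Integrable (fun u => |((γ * |Real.log u|) ^ p - m) / σ| ^ (2 + 2 * r)) unif := by
    refine hdom.mono' (by fun_prop : Measurable _).aestronglyMeasurable
      (Eventually.of_forall fun u => ?_)
    rw [Real.norm_of_nonneg (by positivity)]
    exact hpt u
  refine ⟨hint, (integral_mono hint hdom hpt).trans (le_of_eq ?_)⟩
  rw [integral_add (((integrable_unif_abs_log_rpow hγ hq).div_const _).const_mul _)
    (integrable_const 1), integral_const_mul, integral_div, integral_unif_abs_log_rpow hγ hq]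
  simp

/-! ### Limit theorems for an exact power law -/

namespace IsUniformSample

variable {Ω : Type*} [MeasurableSpace Ω] {P : Measure Ω} [IsProbabilityMeasure P] {U : ℕ → Ω → ℝ}

theorem tendstoInMeasure_power (hU : IsUniformSample U P) {γ : ℝ} (hγ : 0 < γ) {k : ℕ → ℕ}
    (hk : Tendsto k atTop atTop) (hkn : ∀ᶠ n in atTop, k n < n) {p : ℕ → ℝ}
    (hp : Tendsto p atTop atTop) {b : ℝ} (hb : 1 < b)
    (h : ∀ᶠ n in atTop, b * p n ≤ Real.log (k n)) :
    TendstoInMeasure P (fun n ω => 1 / ((k n : ℝ) * mLim γ (p n)) *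
      ∑ i ∈ Finset.Icc 1 (k n), (γ * |Real.log (orderStat (fun j => U j ω) n i /
        orderStat (fun j => U j ω) n (k n + 1))|) ^ (p n)) atTop (fun _ => 1) := by
  rw [tendstoInMeasure_iff_norm]
  intro δ hδ
  -- The truncation argument needs `r ≤ 1`, the moment growth needs `r < b - 1`.
  obtain ⟨r, hr, hrb⟩ := exists_between (show (0 : ℝ) < min 1 (b - 1) by
    rw [lt_min_iff]; constructor <;> linarith)
  rw [lt_min_iff] at hrb
  have hmom := tendsto_mLim_ratio_div hγ hp hk (η := b - 1) hr hrb.2 (by simpa using h)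
  have hbound : Tendsto (fun n => ENNReal.ofReal ((1 + 4 / δ ^ 2) *
      (mLim γ ((1 + r) * p n) / mLim γ (p n) ^ (1 + r) / (k n : ℝ) ^ r))) atTop (𝓝 0) := by
    simpa using ENNReal.tendsto_ofReal (hmom.const_mul (1 + 4 / δ ^ 2))
  refine tendsto_of_tendsto_of_tendsto_of_le_of_le' tendsto_const_nhds hbound
    (Eventually.of_forall fun _ => zero_le) ?_
  filter_upwards [hkn, hk.eventually_ge_atTop 1, hp.eventually_gt_atTop 0,
    hmom.eventually_le_const (show 0 < δ / 2 by positivity)] with n hkn hk1 hp0 hsmall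
  have hm := mLim_pos (γ := γ) (q := p n) hγ (by linarith)
  let f : ℝ → ℝ := fun u => (γ * |Real.log u|) ^ (p n) / mLim γ (p n)
  have hf : Measurable f := by fun_prop
  have hf0 : ∀ u, 0 ≤ f u := fun u => by positivity
  have hfi : Integrable f unif := (integrable_unif_abs_log_rpow hγ (by linarith)).div_const _
  have hf1 : ∫ u, f u ∂unif = 1 := by
    rw [integral_div, integral_unif_abs_log_rpow hγ (by linarith), div_self hm.ne']
  have hpow : ∀ u, f u ^ (1 + r) =
      (γ * |Real.log u|) ^ ((1 + r) * p n) / mLim γ (p n) ^ (1 + r) := by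
    intro u
    rw [Real.div_rpow (by positivity) hm.le, ← Real.rpow_mul (by positivity), mul_comm (p n)]
  have hq : -1 < (1 + r) * p n := by nlinarith
  have hfr : Integrable (fun u => f u ^ (1 + r)) unif := by
    simp only [hpow]
    exact (integrable_unif_abs_log_rpow hγ hq).div_const _
  have hfr1 : ∫ u, f u ^ (1 + r) ∂unif = mLim γ ((1 + r) * p n) / mLim γ (p n) ^ (1 + r) := by
    simp only [hpow]
    rw [integral_div, integral_unif_abs_log_rpow hγ hq]
  have hmain := hU.measure_average_sub_one_ge_le hf hf0 hfi hf1 hr hrb.1.le hfr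
    (k := k n) hk1 hδ (by rw [hfr1]; exact hsmall)
  rw [hfr1] at hmain
  refine le_trans (le_of_eq ?_) hmain
  let B : Set ℝ := {x | δ ≤ |1 / (k n : ℝ) * x - 1|}
  have hB : MeasurableSet B := measurableSet_le measurable_const (by fun_prop)
  have hlaw := hU.measure_sum_orderStat_ratio hkn hf hB
  refine Eq.trans ?_ hlaw
  congr 1
  ext ω
  simp only [B, f, mem_ofPred_eq, Real.norm_eq_abs]
  rw [← Finset.sum_div, one_div_mul_eq_div, one_div_mul_eq_div, div_div, mul_comm (mLim γ (p n))]

theorem tendstoInDistribution_power (hU : IsUniformSample U P) {γ : ℝ} (hγ : 0 < γ) {k : ℕ → ℕ}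
    (hk : Tendsto k atTop atTop) (hkn : ∀ᶠ n in atTop, k n < n) {p : ℕ → ℝ}
    (hp : Tendsto p atTop atTop) {b : ℝ} (hb : 2 < b)
    (h : ∀ᶠ n in atTop, b * p n ≤ Real.log (k n)) :
    TendstoInDistribution (fun n ω => 1 / (√(k n : ℝ) * sigmaLim γ (p n)) *
      ∑ i ∈ Finset.Icc 1 (k n), ((γ * |Real.log (orderStat (fun j => U j ω) n i /
        orderStat (fun j => U j ω) n (k n + 1))|) ^ (p n) - mLim γ (p n))) atTop
      (id : ℝ → ℝ) (fun _ => P) (gaussianReal 0 1) := by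
  let f : ℕ → ℝ → ℝ := fun n u => ((γ * |Real.log u|) ^ (p n) - mLim γ (p n)) / sigmaLim γ (p n)
  have hf : ∀ n, Measurable (f n) := fun n => by fun_prop
  -- The Lyapunov exponent is `2 + 2 r`: `r < 1/2` keeps the excess `2 r` below `1`, and `b p =
  -- (b/2)(2p)` leaves room for `r < b/2 - 1` at the exponent `2 p`.
  obtain ⟨r, hr, hrb⟩ := exists_between (show (0 : ℝ) < min (1 / 2) (b / 2 - 1) by
    rw [lt_min_iff]; constructor <;> linarith)
  rw [lt_min_iff] at hrb
  have hk' : Tendsto (fun n => (k n : ℝ)) atTop atTop := tendsto_natCast_atTop_atTop.comp hk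
  have hmom := tendsto_mLim_ratio_div hγ (hp.const_mul_atTop two_pos) hk (η := b / 2 - 1) hr hrb.2
    (by filter_upwards [h] with n hn; linarith)
  have hstd := eventually_half_le_sigmaLim_sq hγ hp
  have hc : Tendsto (fun n => (∫ u, |f n u| ^ (2 + 2 * r) ∂unif) / (k n : ℝ) ^ (2 * r / 2)) atTop
      (𝓝 0) := by
    rw [mul_div_cancel_left₀ r two_ne_zero]
    have hlim : Tendsto (fun n => 2 ^ (1 + r) * (mLim γ ((1 + r) * (2 * p n)) /
        mLim γ (2 * p n) ^ (1 + r) / (k n : ℝ) ^ r) + 1 / (k n : ℝ) ^ r) atTop (𝓝 0) := by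
      have h1 := ((tendsto_rpow_atTop hr).comp hk').const_div_atTop 1
      simpa using (hmom.const_mul (2 ^ (1 + r))).add h1
    refine tendsto_of_tendsto_of_tendsto_of_le_of_le' tendsto_const_nhds hlim
      (Eventually.of_forall fun n => ?_) ?_
    · have : 0 ≤ ∫ u, |f n u| ^ (2 + 2 * r) ∂unif := integral_nonneg fun u => by positivity
      positivity
    · filter_upwards [hstd, hp.eventually_gt_atTop 0] with n ⟨h1, h2, h3⟩ hp0
      have h4 := (integral_abs_standardized_rpow_le hγ hp0 hr h1 h2 h3).2
      calc _ ≤ (2 ^ (1 + r) * (mLim γ ((1 + r) * (2 * p n)) / mLim γ (2 * p n) ^ (1 + r)) + 1) /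
            (k n : ℝ) ^ r := by gcongr
        _ = _ := by ring
  have hprop : ∀ᶠ n in atTop, ∫ u, f n u ∂unif = 0 ∧ ∫ u, f n u ^ 2 ∂unif = 1 ∧
      MemLp (f n) 2 unif ∧ Integrable (fun u => |f n u| ^ (2 + 2 * r)) unif := by
    filter_upwards [hstd, hp.eventually_gt_atTop 0] with n ⟨h1, h2, h3⟩ hp0
    have hi1 := integrable_unif_abs_log_rpow (γ := γ) (q := p n) hγ (by linarith)
    have hi2 := integrable_unif_abs_log_rpow (γ := γ) (q := 2 * p n) hγ (by linarith)
    have hsq : ∀ u, f n u ^ 2 = ((γ * |Real.log u|) ^ (2 * p n) -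
        2 * mLim γ (p n) * (γ * |Real.log u|) ^ (p n) + mLim γ (p n) ^ 2) /
          sigmaLim γ (p n) ^ 2 := by
      intro u
      have : (γ * |Real.log u|) ^ (2 * p n) = ((γ * |Real.log u|) ^ (p n)) ^ 2 := by
        rw [mul_comm 2, Real.rpow_mul (by positivity)]
        norm_cast
      simp only [f]
      rw [this, div_pow]
      ring
    have hi3 : Integrable (fun u => (γ * |Real.log u|) ^ (2 * p n) -
        2 * mLim γ (p n) * (γ * |Real.log u|) ^ (p n)) unif := hi2.sub (hi1.const_mul _)
    refine ⟨?_, ?_, ?_, (integral_abs_standardized_rpow_le hγ hp0 hr h1 h2 h3).1⟩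
    · rw [integral_div, integral_sub hi1 (integrable_const _),
        integral_unif_abs_log_rpow hγ (by linarith)]
      simp
    · simp only [hsq]
      rw [integral_div, integral_add hi3 (integrable_const _),
        integral_sub hi2 (hi1.const_mul _), integral_const_mul,
        integral_unif_abs_log_rpow hγ (by linarith), integral_unif_abs_log_rpow hγ (by linarith),
        div_eq_one_iff_eq (by positivity), h2]
      simp
      ring
    · rw [memLp_two_iff_integrable_sq (hf n).aestronglyMeasurable]
      simp only [hsq]
      exact (hi3.add (integrable_const _)).div_const _
  have hchar := fun t => tendsto_charFun_pow_of_moment hf hk (s := 2 * r) (by positivity)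
    (by linarith) hprop hc t
  have hmeas : ∀ n, Measurable fun ω => 1 / (√(k n : ℝ) * sigmaLim γ (p n)) *
      ∑ i ∈ Finset.Icc 1 (k n), ((γ * |Real.log (orderStat (fun j => U j ω) n i /
        orderStat (fun j => U j ω) n (k n + 1))|) ^ (p n) - mLim γ (p n)) := by
    intro n
    refine (Finset.measurable_fun_sum _ fun i _ => ?_).const_mul _
    have h1 := (hU.measurable_orderStat_comp n i).div (hU.measurable_orderStat_comp n (k n + 1))
    have h2 : Measurable fun z : ℝ => (γ * |Real.log z|) ^ (p n) - mLim γ (p n) := by fun_prop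
    exact h2.comp h1
  refine ⟨fun n => (hmeas n).aemeasurable, aemeasurable_id, ?_⟩
  refine ProbabilityMeasure.tendsto_iff_tendsto_charFun.2 fun t => ?_
  simp only [ProbabilityMeasure.coe_mk, Measure.map_id, charFun_gaussianReal]
  refine Tendsto.congr' ?_ (by simpa [neg_div] using hchar t)
  filter_upwards [hkn] with n hn
  have hlaw := hU.map_sum_orderStat_ratio hn (hf n)
  have hm1 : Measurable fun ω => ∑ i ∈ Finset.Icc 1 (k n), f n (orderStat (fun j => U j ω) n i /
      orderStat (fun j => U j ω) n (k n + 1)) :=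
    Finset.measurable_fun_sum _ fun i _ => (hf n).comp
      ((hU.measurable_orderStat_comp n i).div (hU.measurable_orderStat_comp n (k n + 1)))
  have hm2 : Measurable fun ω => ∑ i ∈ Finset.range (k n), f n (U i ω) :=
    Finset.measurable_fun_sum _ fun i _ => (hf n).comp (hU.measurable i)
  rw [← hU.charFun_map_sum (hf n), charFun_map_mul_comp hm2.aemeasurable, ← hlaw,
    ← charFun_map_mul_comp hm1.aemeasurable]
  congr 2
  funext ω
  simp only [f]
  rw [← Finset.sum_div, one_div, mul_inv, div_eq_mul_inv]
  ring

end IsUniformSample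

/-! ### The main theorem -/

theorem tendstoInMeasure_add_of_zero {Ω : Type*} [MeasurableSpace Ω] {P : Measure Ω}
    {f g : ℕ → Ω → ℝ} {c : ℝ} (hf : TendstoInMeasure P f atTop (fun _ => 0))
    (hg : TendstoInMeasure P g atTop (fun _ => c)) :
    TendstoInMeasure P (fun n ω => f n ω + g n ω) atTop (fun _ => c) := by
  rw [tendstoInMeasure_iff_norm] at hf hg ⊢
  intro δ hδ
  have h := (hf (δ / 2) (half_pos hδ)).add (hg (δ / 2) (half_pos hδ))
  rw [add_zero] at h
  refine tendsto_of_tendsto_of_tendsto_of_le_of_le tendsto_const_nhds h (fun _ => zero_le)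
    fun n => ?_
  refine (measure_mono fun ω hω => ?_).trans (measure_union_le _ _)
  rw [mem_union]
  by_contra hcon
  push Not at hcon
  obtain ⟨h1, h2⟩ := hcon
  simp only [mem_ofPred_eq, not_le, sub_zero] at hω h1 h2
  have h3 := norm_add_le (f n ω) (g n ω - c)
  rw [← add_sub_assoc] at h3
  linarith

/-- The bias is negligible compared to the standard deviation when `√k R` grows at a rate below
`2 ^ p`. -/
theorem tendsto_bias_div_sigmaLim {γ : ℝ} (hγ : 0 < γ) {k : ℕ → ℕ} (hk : Tendsto k atTop atTop)
    {p : ℕ → ℝ} (hp : Tendsto p atTop atTop) {ε : ℕ → ℝ} (hε : Tendsto ε atTop (𝓝 0))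
    (hε0 : ∀ᶠ n in atTop, 0 ≤ ε n) {C b : ℝ} (hb : b < Real.log 2)
    (h : ∀ᶠ n in atTop, √(k n : ℝ) * ε n ≤ C * Real.exp (b * p n)) :
    Tendsto (fun n => (k n : ℝ) * (ε n / γ * Real.exp (ε n / γ) * mLim γ (p n)) /
      (√(k n : ℝ) * sigmaLim γ (p n))) atTop (𝓝 0) := by
  have hlim : Tendsto (fun n => C / γ * √(2 * √Real.pi) * Real.exp (ε n / γ) *
      (p n ^ (1 / 2 : ℝ) * Real.exp (-(Real.log 2 - b) * p n))) atTop (𝓝 0) := by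
    have h1 : Tendsto (fun n => Real.exp (ε n / γ)) atTop (𝓝 (Real.exp 0)) := by
      refine (Real.continuous_exp.tendsto 0).comp ?_
      simpa using hε.div_const γ
    have h2 := (tendsto_rpow_mul_exp_neg_mul_atTop_nhds_zero (1 / 2) (Real.log 2 - b)
      (by linarith)).comp hp
    simpa using (h1.const_mul (C / γ * √(2 * √Real.pi))).mul h2
  refine tendsto_of_tendsto_of_tendsto_of_le_of_le' tendsto_const_nhds hlim ?_ ?_
  · filter_upwards [hε0, hp.eventually_gt_atTop 0, eventually_half_le_sigmaLim_sq hγ hp]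
      with n h1 h2 h3
    have := mLim_pos (γ := γ) (q := p n) hγ (by linarith)
    have := h3.1
    positivity
  · filter_upwards [hε0, hp.eventually_ge_atTop 2, eventually_half_le_sigmaLim_sq hγ hp, h,
      hk.eventually_ge_atTop 1] with n h1 h2 ⟨hσ, h3, h4⟩ h5 hk1
    have hk0 : (0 : ℝ) < k n := Nat.cast_pos.2 hk1
    have hsk : 0 < √(k n : ℝ) := Real.sqrt_pos.2 hk0
    have hm := mLim_pos (γ := γ) (q := p n) hγ (by linarith)
    have hM := mLim_pos (γ := γ) (q := 2 * p n) hγ (by linarith)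
    have hp0 : 0 < p n := by linarith
    -- From `mLim_sq_le` and `m_{2p} ≤ 2 σ_p ^ 2`. The decay `exp (-(log 2) p)` defeats the allowed
    -- growth `exp (b p)`.
    have hmσ : mLim γ (p n) / sigmaLim γ (p n) ≤
        √(2 * √Real.pi) * p n ^ (1 / 2 : ℝ) * Real.exp (-(Real.log 2 * p n)) := by
      rw [div_le_iff₀ hσ]
      refine le_of_sq_le_sq ?_ (by positivity)
      have hexp : Real.exp (-(Real.log 2 * p n)) ^ 2 = Real.exp (-(2 * Real.log 2 * p n)) := by
        rw [← Real.exp_nat_mul]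
        congr 1
        push_cast
        ring
      have hpp : (p n ^ (1 / 2 : ℝ)) ^ 2 = p n := by
        rw [← Real.sqrt_eq_rpow, Real.sq_sqrt hp0.le]
      rw [mul_pow, mul_pow, mul_pow, hexp, hpp, Real.sq_sqrt (by positivity)]
      calc mLim γ (p n) ^ 2 ≤ _ := mLim_sq_le hγ h2
        _ ≤ √Real.pi * p n * Real.exp (-(2 * Real.log 2 * p n)) *
            (2 * sigmaLim γ (p n) ^ 2) := by
          gcongr
          linarith
        _ = _ := by ring
    calc _ = √(k n : ℝ) * ε n * (Real.exp (ε n / γ) / γ) *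
          (mLim γ (p n) / sigmaLim γ (p n)) := by
          have : (k n : ℝ) = √(k n : ℝ) * √(k n : ℝ) := (Real.mul_self_sqrt hk0.le).symm
          nth_rewrite 1 [this]
          field_simp
      _ ≤ C * Real.exp (b * p n) * (Real.exp (ε n / γ) / γ) *
          (√(2 * √Real.pi) * p n ^ (1 / 2 : ℝ) * Real.exp (-(Real.log 2 * p n))) := by
          gcongr
          exact mul_nonneg ((mul_nonneg hsk.le h1).trans h5) (by positivity)
      _ = C / γ * √(2 * √Real.pi) * Real.exp (ε n / γ) * (p n ^ (1 / 2 : ℝ) *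
          (Real.exp (b * p n) * Real.exp (-(Real.log 2 * p n)))) := by ring
      _ = _ := by
          rw [← Real.exp_add]
          congr 3
          ring

theorem mainTheorem5
    -- the common distribution `ν` of the observations, with quantile function `Q(1-s) = s^{-γ} ℓ(s)`
    (ν : Measure ℝ) [IsProbabilityMeasure ν]
    (γ : ℝ) (hγ : 0 < γ) (ℓ : ℝ → ℝ) (hℓ : SlowlyVaryingAtZero ℓ)
    (hQ : ∀ s ∈ Ioo (0 : ℝ) 1, quantile ν (1 - s) = s ^ (-γ) * ℓ s)
    -- the second-order condition
    (a : ℝ → ℝ) (ρ : ℝ) (ha : RegularlyVaryingAtZero a ρ)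
    (hℓa : UniformSecondOrder ℓ a)
    (haℓ : Tendsto (fun v => a v / ℓ v) (𝓝[>] 0) (𝓝 0))
    -- `U 0, U 1, …` are iid uniform on `(0, 1)`
    {Ω : Type*} [MeasurableSpace Ω] (P : Measure Ω) [IsProbabilityMeasure P]
    (U : ℕ → Ω → ℝ) (hUm : ∀ i, Measurable (U i)) (hUind : iIndepFun U P)
    (hUlaw : ∀ i, P.map (U i) = volume.restrict (Ioo (0 : ℝ) 1))
    -- the sequences `k_n` and `p_n`
    (k : ℕ → ℕ) (hk : Tendsto k atTop atTop)
    (hkn : Tendsto (fun n => (k n : ℝ) / n) atTop (𝓝 0))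
    (p : ℕ → ℝ) (hp : Tendsto p atTop atTop)
    (hpa : Tendsto (fun n : ℕ => p n * (a ((k n : ℝ) / n) / ℓ ((k n : ℝ) / n))) atTop (𝓝 0))
    (α : EReal) (hα : α = liminf (fun n => ((Real.log (k n) / p n : ℝ) : EReal)) atTop) :
    (1 < α →
      TendstoInMeasure P
        (fun n ω => 1 / ((k n : ℝ) * mLim γ (p n)) *
          ∑ i ∈ Finset.Icc 1 (k n), logExcessPow ν (fun j => U j ω) n (k n) (p n) i)
        atTop (fun _ => 1)) ∧
    (2 < α →
      limsup (fun n : ℕ => (((p n)⁻¹ *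
          Real.log (√(k n : ℝ) * (a ((k n : ℝ) / n) / ℓ ((k n : ℝ) / n))) : ℝ) : EReal)) atTop
        < ((Real.log 2 : ℝ) : EReal) →
      TendstoInDistribution
        (fun n ω => 1 / (√(k n : ℝ) * sigmaLim γ (p n)) *
          ∑ i ∈ Finset.Icc 1 (k n),
            (logExcessPow ν (fun j => U j ω) n (k n) (p n) i - mLim γ (p n)))
        atTop (id : ℝ → ℝ) (fun _ => P) (gaussianReal 0 1)) := by
  have hU : IsUniformSample U P := ⟨hUm, hUind, hUlaw⟩
  obtain ⟨C, hC, hCv⟩ := exists_abs_log_ratio_le hℓ ha hℓa haℓ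
  have hv : Tendsto (fun n => (k n : ℝ) / n) atTop (𝓝[>] 0) := by
    refine tendsto_nhdsWithin_iff.2 ⟨hkn, ?_⟩
    filter_upwards [hk.eventually_ge_atTop 1, eventually_gt_atTop 0] with n h1 h2
    have h1' : (0 : ℝ) < k n := Nat.cast_pos.2 h1
    have h2' : (0 : ℝ) < n := Nat.cast_pos.2 h2
    exact div_pos h1' h2'
  set R : ℕ → ℝ := fun n => a ((k n : ℝ) / n) / ℓ ((k n : ℝ) / n)
  have hR : ∀ᶠ n in atTop, 0 < R n := (hv.eventually hCv).mono fun n h => h.1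
  have hεlim : Tendsto (fun n => C * R n) atTop (𝓝 0) := by
    simpa using (haℓ.comp hv).const_mul C
  have hε : ∀ᶠ n in atTop, 0 ≤ C * R n ∧ ∀ x ∈ Ioc (0 : ℝ) (2 * ((k n : ℝ) / n)), 0 < ℓ x ∧
      ∀ y ∈ Ioc (0 : ℝ) (2 * ((k n : ℝ) / n)), |Real.log (ℓ x / ℓ y)| ≤ C * R n :=
    (hv.eventually hCv).mono fun n h => ⟨mul_nonneg hC.le h.1.le, h.2⟩
  have hklt : ∀ᶠ n in atTop, k n < n := by
    filter_upwards [hkn.eventually_lt_const one_pos, eventually_gt_atTop 0] with n h1 h2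
    rw [div_lt_one (Nat.cast_pos.2 h2)] at h1
    exact_mod_cast h1
  constructor
  · intro hα1
    obtain ⟨b, hb, hbk⟩ := exists_eventually_mul_le_of_lt_liminf (c := 1) hp
      (x := fun n => Real.log (k n)) (by rw [← hα]; exact_mod_cast hα1)
    have hs : ∀ᶠ n in atTop, 0 < (k n : ℝ) * mLim γ (p n) := by
      filter_upwards [hk.eventually_ge_atTop 1, hp.eventually_gt_atTop 0] with n h1 h2
      exact mul_pos (Nat.cast_pos.2 h1) (mLim_pos hγ (by linarith))
    -- At the scale `k m_p` the mean error is just `(ε/γ) exp (ε/γ)`.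
    have hlim : Tendsto (fun n => (k n : ℝ) * (C * R n / γ * Real.exp (C * R n / γ) *
        mLim γ (p n)) / ((k n : ℝ) * mLim γ (p n))) atTop (𝓝 0) := by
      have h1 : Tendsto (fun n => C * R n / γ) atTop (𝓝 0) := by
        simpa using hεlim.div_const γ
      have h2 := h1.mul ((Real.continuous_exp.tendsto 0).comp h1)
      rw [zero_mul] at h2
      refine Tendsto.congr' ?_ h2
      filter_upwards [hs] with n hn
      rw [eq_div_iff hn.ne']
      simp only [Function.comp_apply]
      ring
    refine (tendstoInMeasure_add_of_zero
      (hU.tendstoInMeasure_sum_logExcessPow_sub hγ hQ hk hkn hp hε hs hlim)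
      (hU.tendstoInMeasure_power hγ hk hklt hp hb hbk)).congr_left
        fun n => Eventually.of_forall fun ω => ?_
    simp only
    ring
  · intro hα2 hbias
    obtain ⟨b, hb, hbk⟩ := exists_eventually_mul_le_of_lt_liminf (c := 2) hp
      (x := fun n => Real.log (k n)) (by rw [← hα]; exact_mod_cast hα2)
    -- A real rate strictly between the limsup and `log 2`; exponentiating turns it into a bound on
    -- `√k R`, which is eventually positive.
    obtain ⟨d, hd, hd2⟩ := EReal.lt_iff_exists_real_btwn.1 hbias
    have hgrowth : ∀ᶠ n in atTop, √(k n : ℝ) * (C * R n) ≤ C * Real.exp (d * p n) := by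
      filter_upwards [eventually_lt_of_limsup_lt hd, hR, hk.eventually_ge_atTop 1,
        hp.eventually_gt_atTop 0] with n h1 h2 h3 h4
      have h5 : 0 < √(k n : ℝ) * R n := mul_pos (Real.sqrt_pos.2 (Nat.cast_pos.2 h3)) h2
      rw [EReal.coe_lt_coe_iff, inv_mul_lt_iff₀ h4, mul_comm (p n)] at h1
      have h6 := (Real.log_le_iff_le_exp h5).1 h1.le
      calc √(k n : ℝ) * (C * R n) = C * (√(k n : ℝ) * R n) := by ring
        _ ≤ _ := by gcongr
    have hs : ∀ᶠ n in atTop, 0 < √(k n : ℝ) * sigmaLim γ (p n) := by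
      filter_upwards [hk.eventually_ge_atTop 1, eventually_half_le_sigmaLim_sq hγ hp] with n h1 h2
      exact mul_pos (Real.sqrt_pos.2 (Nat.cast_pos.2 h1)) h2.1
    have hlim := tendsto_bias_div_sigmaLim hγ hk hp hεlim (hε.mono fun n h => h.1)
      (EReal.coe_lt_coe_iff.1 hd2) hgrowth
    -- Slutsky: the exact power law gives the Gaussian limit, and the difference vanishes in
    -- probability.
    refine tendstoInDistribution_of_tendstoInMeasure_sub _ _
      (hU.tendstoInDistribution_power hγ hk hklt hp hb hbk) ?_ fun n => ?_
    · refine (hU.tendstoInMeasure_sum_logExcessPow_sub hγ hQ hk hkn hp hε hs hlim).congr_left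
        fun n => Eventually.of_forall fun ω => ?_
      simp only [Pi.sub_apply, Finset.sum_sub_distrib]
      ring
    · exact ((Finset.measurable_fun_sum _ fun i _ =>
        (hU.measurable_logExcessPow ν n (k n) i (p n)).sub_const _).const_mul _).aemeasurable
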